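/- **Setting.** Let $\mathcal X$ be a measurable space, $L\ge 1$, $[L]=\{1,\dots,L\}$, $\mathbf g=(g_1,\dots,g_L):\mathcal X\to\Delta^{L-1}$ a measurable base model, and let the calibration data $\mathcal D=((X_1,Y_1),\dots,(X_n,Y_n))$ consist of $n$ independent draws from a distribution $P$ on $\mathcal X\times[L]$. **Binary histogram binning** (predictor $g$, data $(X_i,y_i)\in\mathcal X\times\{0,1\}$, number of bins $B$, tie-breaking parameter $\delta>0$). For $s\in[0,1]$ let a *$\delta$-perturbation* of $s$ be $(s+\delta U)/(1+\delta)$ with a fresh independent $U\sim\mathrm{Unif}[0,1]$. Let $S_1,\dots,S_n$ be $\delta$-perturbations of $g(X_1),\dots,g(X_n)$, let $S_{(1)}\le\dots\le S_{(n)}$ be their order statistics with corresponding labels $y_{(1)},\dots,y_{(n)}$, and put $S_{(0)}=0$, $S_{(n+1)}=1$. With $A_b=\lceil b(n+1)/B\rceil$, the bins are $[S_{(A_{b-1})},S_{(A_b)})$, $b=1,\dots,B$ (the last one closed on the right). The value $\widehat\Pi_b$ of bin $b$ is a $\delta$-perturbation of the mean of the $y_{(j)}$ with $A_{b-1}<j<A_b$.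 The output predictor $h$ maps $x$ to $\widehat\Pi_b$, where $b$ is the bin that contains a $\delta$-perturbation of $g(x)$. **Class-wise histogram binning** (points per bin $k_1,\dots,k_L$, tie-breaking parameter $\delta$) returns $\mathbf h=(h_1,\dots,h_L)$, where $h_l$ is the output of binary histogram binning for $g_l$, the data $(X_i,\mathbf 1\{Y_i=l\})_{i\le n}$, $B=\lfloor n/k_l\rfloor$ bins, and $\delta$; all perturbations use independent randomness. **Calibration.** Let $(X,Y)\sim P$ be a test point independent of $\mathcal D$ and of the internal randomness of the algorithm. Below, $P(Y=l\mid\cdot)$ and $\mathbb E_X$ are taken for the given (learnt) $\mathbf h$, over the test point and the perturbation of its score, while $\Pr$ and $\mathbb E$ are also over $\mathcal D$ and all randomness of the algorithm. For $\boldsymbol\varepsilon=(\varepsilon_l)$, $\boldsymbol\alpha=(\alpha_l)$ an algorithm $(\mathbf g,\mathcal D)\mapsto\mathbf h$ is * *$(\boldsymbol\varepsilon,\boldsymbol\alpha)$-marginally class-wise calibrated* if for every $\mathbf g$, every $P$ and every $l\in[L]$, $\Pr\big(|P(Y=l\mid h_l(X))-h_l(X)|\le\varepsilon_l\big)\ge1-\alpha_l$;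 * *$(\boldsymbol\varepsilon,\boldsymbol\alpha)$-conditionally class-wise calibrated* if for every $\mathbf g$, every $P$ and every $l\in[L]$, $\Pr\big(\forall r\in\mathrm{Range}(h_l):\ |P(Y=l\mid h_l(X)=r)-r|\le\varepsilon_l\big)\ge1-\alpha_l$. Moreover $\text{CW-ECE}(\mathbf h)=L^{-1}\sum_{l=1}^L\mathbb E_X\,|P(Y=l\mid h_l(X))-h_l(X)|$. **Theorem.** Let $\delta>0$, let $k_1,\dots,k_L\ge2$ be integers with $n\ge k_l$ for every $l\in[L]$, and let $\alpha_1,\dots,\alpha_L\in(0,1)$. Put $$\varepsilon^{(1)}_l=\sqrt{\frac{\log(2/\alpha_l)}{2(k_l-1)}}+\delta,\qquad \varepsilon^{(2)}_l=\sqrt{\frac{\log\big(2n/(k_l\alpha_l)\big)}{2(k_l-1)}}+\delta .$$ Then class-wise histogram binning is $(\boldsymbol\varepsilon^{(1)},\boldsymbol\alpha)$-marginally and $(\boldsymbol\varepsilon^{(2)},\boldsymbol\alpha)$-conditionally class-wise calibrated. Further, for every measurable $\mathbf g$ and every distribution $P$ on $\mathcal X\times[L]$, (a) $\Pr\big(\text{CW-ECE}(\mathbf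 h)\le\max_{l}\varepsilon^{(2)}_l\big)\ge1-\sum_{l}\alpha_l$, and (b) $\mathbb E[\text{CW-ECE}(\mathbf h)]\le\max_{l}\sqrt{1/(2k_l)}+\delta$. -/

import Mathlib

open MeasureTheory ProbabilityTheory
open scoped unitInterval

noncomputable section

namespace ClasswiseHB

/-! ### Binary histogram binning with randomized tie-breaking -/

/-- Perturbation of a number `s ∈ [0,1]` by `u ∈ [0,1]` (drawn uniformly) at scale `δ`;
the result is again in `[0,1]` and differs from `s` by at most `δ`. -/
def nudge (δ : ℝ) (u : I) (s : ℝ) : ℝ := (s + δ * u) / (1 + δ)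

/-- The ranks `⌈b (n + 1) / B⌉`, `b = 0, …, B`, of the order statistics that delimit `B` bins of
(nearly) equal size; the first is `0` and the last is `n + 1`. -/
def binCut (n B b : ℕ) : ℕ := ⌈((b : ℚ) * (n + 1)) / B⌉₊

/-- The order statistics `t₍₁₎ ≤ … ≤ t₍ₙ₎`, with the conventions `t₍₀₎ = 0` and `t₍ₙ₊₁₎ = 1`. -/
def orderStat {n : ℕ} (t : Fin n → ℝ) : ℕ → ℝ
  | 0 => 0
  | j + 1 => if h : j < n then t (Tuple.sort t ⟨j, h⟩) else 1

/-- The sample positions (in sorted order) strictly between the two end points of bin `b`.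
The position `i : Fin n` has rank `i + 1`. -/
def binPositions (n B : ℕ) (b : Fin B) : Finset (Fin n) :=
  Finset.univ.filter fun i =>
    binCut n B b < (i : ℕ) + 1 ∧ (i : ℕ) + 1 < binCut n B ((b : ℕ) + 1)

/-- The average label of the sample points strictly between the end points of bin `b`, the sample
being sorted by the scores `t`. -/
def binMean {n : ℕ} (B : ℕ) (t y : Fin n → ℝ) (b : Fin B) : ℝ :=
  (∑ i ∈ binPositions n B b, y (Tuple.sort t i)) / ((binPositions n B b).card : ℝ)

/-- The score `s` is in bin `b`: the bins are half-open intervals, except that the last one also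
contains its right end point `1`. -/
def InBin {n : ℕ} (B : ℕ) (t : Fin n → ℝ) (b : Fin B) (s : ℝ) : Prop :=
  orderStat t (binCut n B b) ≤ s ∧
    (s < orderStat t (binCut n B ((b : ℕ) + 1)) ∨ (b : ℕ) + 1 = B)

open Classical in
/-- Binary histogram binning (uniform-mass, without sample splitting), applied to the binary
predictor `g`, the sample `D` of (feature, 0/1-label) pairs, the number `B` of bins and the
tie-breaking parameter `δ`. The seeds `U` perturb the scores of the sample, the seeds `V` perturb
the output of each bin. The result is the piecewise constant predictor that sends `x` to the
perturbed average label of the bin of the score of `x`; this score is perturbed by the seed `z`. -/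
def binaryHB {X : Type*} {n : ℕ} (g : X → ℝ) (D : Fin n → X × ℝ) (B : ℕ) (δ : ℝ)
    (U : Fin n → I) (V : Fin B → I) (x : X) (z : I) : ℝ :=
  let t : Fin n → ℝ := fun i => nudge δ (U i) (g (D i).1)
  let y : Fin n → ℝ := fun i => (D i).2
  ∑ b : Fin B, if InBin B t b (nudge δ z (g x)) then nudge δ (V b) (binMean B t y b) else 0

/-! ### Algorithms for class-wise calibration -/

/-- A (randomized) algorithm for class-wise calibration: from a base model `g : X → Δ^{L-1}` and
`n` calibration points it produces, with the help of an internal seed in `Ω`, an `L`-tuple of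
predictors, which may use a further seed in `Z` at test time. -/
abbrev Calibrator (X : Type*) (L n : ℕ) (Ω Z : Type*) :=
  (X → stdSimplex ℝ (Fin L)) → (Fin n → X × Fin L) → Ω → X → Z → Fin L → ℝ

/-- Internal seeds of class-wise histogram binning: for each class, one for each calibration point
and one for each of the `⌊n / k l⌋` bins. The volume makes them all independent and uniform. -/
abbrev Seed (L n : ℕ) (k : Fin L → ℕ) : Type :=
  (Fin L → Fin n → I) × ((l : Fin L) → Fin (n / k l) → I)

/-- Class-wise histogram binning with `k l` points per bin for class `l` and tie-breaking
parameter `δ`: for each class `l`, binary histogram binning with `⌊n / k l⌋` bins is applied to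
`g_l` and the data `(X_i, 1{Y_i = l})`, `i = 1, …, n`. -/
def classwiseHB (X : Type*) (L n : ℕ) (k : Fin L → ℕ) (δ : ℝ) :
    Calibrator X L n (Seed L n k) (Fin L → I) :=
  fun g D ω x z l =>
    binaryHB (fun x' => (g x' : Fin L → ℝ) l)
      (fun i => ((D i).1, if (D i).2 = l then 1 else 0)) (n / k l) δ (ω.1 l) (ω.2 l) x (z l)

/-! ### Calibration -/

/-- The event `S` has probability at least `p` (and contains a measurable event that has). -/
def ProbAtLeast {Ω : Type*} [MeasurableSpace Ω] (μ : Measure Ω) (S : Set Ω) (p : ℝ) : Prop :=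
  ∃ E ⊆ S, MeasurableSet E ∧ p ≤ μ.real E

section

variable {X : Type*} [MeasurableSpace X] {L n : ℕ} [NeZero L]
  {Ω : Type*} [MeasureSpace Ω] {Z : Type*} [MeasureSpace Z]
  [IsProbabilityMeasure (volume : Measure Z)]

/-- The conditional probability `P(Y = l ∣ f(X) = r)` for a fixed predictor `f`, where
`(X, Y) ∼ P` is independent of the test-time seed of `f`. -/
def classProb (P : Measure (X × Fin L)) [IsProbabilityMeasure P] (f : X → Z → ℝ)
    (l : Fin L) (r : ℝ) : ℝ :=
  (condDistrib (fun ω : (X × Fin L) × Z => ω.1.2) (fun ω => f ω.1.1 ω.2)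
    (P.prod (volume : Measure Z)) r).real {l}

/-- The class-wise expected calibration error
`CW-ECE(h) = L⁻¹ ∑_l E |P(Y = l ∣ h_l(X)) - h_l(X)|` of a fixed predictor `h`. -/
def cwECE (P : Measure (X × Fin L)) [IsProbabilityMeasure P] (h : X → Z → Fin L → ℝ) : ℝ :=
  (L : ℝ)⁻¹ * ∑ l : Fin L, ∫ ω : (X × Fin L) × Z,
    |classProb P (fun x z => h x z l) l (h ω.1.1 ω.2 l) - h ω.1.1 ω.2 l|
      ∂(P.prod (volume : Measure Z))

/-- The joint law of the calibration data, `n` independent draws from `P`, and of the internal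
seed of the algorithm. -/
def trainLaw (n : ℕ) (Ω : Type*) [MeasureSpace Ω] (P : Measure (X × Fin L)) :
    Measure ((Fin n → X × Fin L) × Ω) :=
  (Measure.pi fun _ : Fin n => P).prod (volume : Measure Ω)

/-- `(ε, α)`-marginal class-wise calibration: for every `P` and `l`,
`Pr(|P(Y = l ∣ h_l(X)) - h_l(X)| ≤ ε_l) ≥ 1 - α_l`, where the outer probability is over the
calibration data, the test point and all seeds, and the inner one is for the given `h`. -/
def MarginallyCalibrated (A : Calibrator X L n Ω Z) (ε α : Fin L → ℝ) : Prop :=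
  ∀ g : X → stdSimplex ℝ (Fin L), Measurable g →
  ∀ (P : Measure (X × Fin L)) [IsProbabilityMeasure P], ∀ l : Fin L,
    ProbAtLeast ((trainLaw n Ω P).prod (P.prod (volume : Measure Z)))
      {ω | |classProb P (fun x z => A g ω.1.1 ω.1.2 x z l) l (A g ω.1.1 ω.1.2 ω.2.1.1 ω.2.2 l)
          - A g ω.1.1 ω.1.2 ω.2.1.1 ω.2.2 l| ≤ ε l}
      (1 - α l)

/-- `(ε, α)`-conditional class-wise calibration: for every `P` and `l`,
`Pr(∀ r ∈ Range(h_l), |P(Y = l ∣ h_l(X) = r) - r| ≤ ε_l) ≥ 1 - α_l`. -/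
def ConditionallyCalibrated (A : Calibrator X L n Ω Z) (ε α : Fin L → ℝ) : Prop :=
  ∀ g : X → stdSimplex ℝ (Fin L), Measurable g →
  ∀ (P : Measure (X × Fin L)) [IsProbabilityMeasure P], ∀ l : Fin L,
    ProbAtLeast (trainLaw n Ω P)
      {ω | ∀ r ∈ Set.range (fun q : X × Z => A g ω.1 ω.2 q.1 q.2 l),
          |classProb P (fun x z => A g ω.1 ω.2 x z l) l r - r| ≤ ε l}
      (1 - α l)

end

end ClasswiseHB

end

namespace ClasswiseHB

/-! ### Order statistics -/

section OrderStatistics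

variable {n : ℕ}

lemma orderStat_zero (t : Fin n → ℝ) : orderStat t 0 = 0 := rfl

lemma orderStat_succ (t : Fin n → ℝ) {j : ℕ} (h : j < n) :
    orderStat t (j + 1) = t (Tuple.sort t ⟨j, h⟩) := dif_pos h

lemma orderStat_last (t : Fin n → ℝ) : orderStat t (n + 1) = 1 := dif_neg (lt_irrefl n)

lemma orderStat_succ_le_iff (t : Fin n → ℝ) {j : ℕ} (h : j < n) (v : ℝ) :
    orderStat t (j + 1) ≤ v ↔ j < (Finset.univ.filter fun i => t i ≤ v).card := by
  rw [orderStat_succ t h]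
  refine (Tuple.lt_card_le_iff_apply_le_of_monotone (a := v) (j := ⟨j, h⟩)
    (Tuple.monotone_sort t)).symm.trans ?_
  have hc : (Finset.univ.filter fun i => (t ∘ Tuple.sort t) i ≤ v).card =
      (Finset.univ.filter fun i => t i ≤ v).card :=
    Finset.card_equiv (Tuple.sort t) (by simp)
  rw [hc]

lemma orderStat_succ_lt_iff (t : Fin n → ℝ) {j : ℕ} (h : j < n) (v : ℝ) :
    orderStat t (j + 1) < v ↔ j < (Finset.univ.filter fun i => t i < v).card := by
  rw [orderStat_succ t h]
  refine (Tuple.lt_card_lt_iff_apply_lt_of_monotone (a := v) (j := ⟨j, h⟩)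
    (Tuple.monotone_sort t)).symm.trans ?_
  have hc : (Finset.univ.filter fun i => (t ∘ Tuple.sort t) i < v).card =
      (Finset.univ.filter fun i => t i < v).card :=
    Finset.card_equiv (Tuple.sort t) (by simp)
  rw [hc]

lemma orderStat_mem_Icc {t : Fin n → ℝ} (ht : ∀ i, t i ∈ Set.Icc (0 : ℝ) 1) (j : ℕ) :
    orderStat t j ∈ Set.Icc (0 : ℝ) 1 := by
  cases j with
  | zero => simp [orderStat_zero]
  | succ j =>
    by_cases h : j < n
    · rw [orderStat_succ t h]; exact ht _
    · simp [orderStat, h]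

lemma orderStat_mono {t : Fin n → ℝ} (ht : ∀ i, t i ∈ Set.Icc (0 : ℝ) 1) :
    Monotone (orderStat t) := by
  refine monotone_nat_of_le_succ fun j => ?_
  cases j with
  | zero => rw [orderStat_zero]; exact (orderStat_mem_Icc ht _).1
  | succ j =>
    by_cases h : j + 1 < n
    · rw [orderStat_succ t h, orderStat_succ t (by omega : j < n)]
      exact Tuple.monotone_sort t (by simp)
    · have : orderStat t (j + 1 + 1) = 1 := by simp [orderStat, h]
      rw [this]
      exact (orderStat_mem_Icc ht _).2

/-- The indices of the points whose rank is strictly between `a` and `c`. -/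
noncomputable def midIdx (a c : ℕ) (t : Fin n → ℝ) : Finset (Fin n) :=
  (Finset.univ.filter fun i : Fin n => a < (i : ℕ) + 1 ∧ (i : ℕ) + 1 < c).map
    (Tuple.sort t).toEmbedding

/-- The tuple `t` with the entries in `T` replaced by `1`. -/
noncomputable def mask (T : Finset (Fin n)) (t : Fin n → ℝ) : Fin n → ℝ :=
  fun i => if i ∈ T then 1 else t i

lemma card_filter_between {a c : ℕ} (hc : c ≤ n + 1) :
    (Finset.univ.filter fun i : Fin n => a < (i : ℕ) + 1 ∧ (i : ℕ) + 1 < c).card = c - 1 - a := by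
  rw [← Finset.card_map Fin.valEmbedding, ← Nat.card_Ico]
  congr 1
  ext j
  simp only [Finset.mem_map, Finset.mem_filter, Finset.mem_univ, true_and, Fin.valEmbedding_apply,
    Finset.mem_Ico]
  constructor
  · rintro ⟨i, hi, rfl⟩; omega
  · intro hj; exact ⟨⟨j, by omega⟩, by simp; omega, rfl⟩

lemma card_midIdx {a c : ℕ} (hc : c ≤ n + 1) (t : Fin n → ℝ) :
    (midIdx a c t).card = c - 1 - a := by
  rw [midIdx, Finset.card_map, card_filter_between hc]

lemma card_lt_sort {t : Fin n → ℝ} (hinj : Function.Injective t) (p : Fin n) :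
    (Finset.univ.filter fun r => t r < t (Tuple.sort t p)).card = p := by
  have hm : StrictMono (t ∘ Tuple.sort t) :=
    (Tuple.monotone_sort t).strictMono_of_injective (hinj.comp (Tuple.sort t).injective)
  rw [← Fin.card_Iio p]
  symm
  refine Finset.card_equiv (Tuple.sort t) fun q => ?_
  simp only [Finset.mem_Iio, Finset.mem_filter, Finset.mem_univ, true_and]
  exact hm.lt_iff_lt.symm

lemma mem_midIdx_iff {t : Fin n → ℝ} (hinj : Function.Injective t) {a c : ℕ} {i : Fin n} :
    i ∈ midIdx a c t ↔ a ≤ (Finset.univ.filter fun r => t r < t i).card ∧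
      (Finset.univ.filter fun r => t r < t i).card + 1 < c := by
  obtain ⟨p, rfl⟩ := (Tuple.sort t).surjective i
  rw [card_lt_sort hinj, midIdx]
  simp only [Finset.mem_map_equiv, Equiv.symm_apply_apply, Finset.mem_filter, Finset.mem_univ,
    true_and]
  omega

lemma orderStat_lt_of_mem_midIdx {t : Fin n → ℝ} (hinj : Function.Injective t)
    (ht : ∀ i, t i ∈ Set.Ioo (0 : ℝ) 1) {a c : ℕ} {i : Fin n}
    (hi : i ∈ midIdx a c t) : orderStat t a < t i := by
  have h := (mem_midIdx_iff hinj).1 hi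
  cases a with
  | zero => exact (ht i).1
  | succ a =>
    have : a < n := by
      have := (Finset.card_filter_le Finset.univ fun r => t r < t i)
      simp only [Finset.card_univ, Fintype.card_fin] at this
      omega
    rw [orderStat_succ_lt_iff t this]
    omega

lemma lt_orderStat_of_mem_midIdx {t : Fin n → ℝ} (hinj : Function.Injective t)
    (ht : ∀ i, t i ∈ Set.Ioo (0 : ℝ) 1) {a c : ℕ} (hc : c ≤ n + 1) {i : Fin n}
    (hi : i ∈ midIdx a c t) : t i < orderStat t c := by
  obtain ⟨p, rfl⟩ := (Tuple.sort t).surjective i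
  have h := (mem_midIdx_iff hinj).1 hi
  rw [card_lt_sort hinj] at h
  obtain ⟨c, rfl⟩ : ∃ d, c = d + 1 := ⟨c - 1, by omega⟩
  rcases Nat.lt_or_ge c n with hcn | hcn
  · have hm : StrictMono (t ∘ Tuple.sort t) :=
      (Tuple.monotone_sort t).strictMono_of_injective (hinj.comp (Tuple.sort t).injective)
    rw [orderStat_succ t hcn]
    exact hm (show p < ⟨c, hcn⟩ from Fin.lt_def.2 (by simp; omega))
  · obtain rfl : c = n := by omega
    rw [orderStat_last]
    exact (ht _).2

lemma orderStat_mask_left {t : Fin n → ℝ} (hinj : Function.Injective t)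
    (ht : ∀ i, t i ∈ Set.Ioo (0 : ℝ) 1) {a c : ℕ} (hac : a + 1 < c) (hc : c ≤ n + 1) :
    orderStat (mask (midIdx a c t) t) a = orderStat t a := by
  cases a with
  | zero => rfl
  | succ a =>
    have han : a < n := by omega
    apply le_antisymm
    · rw [orderStat_succ_le_iff _ han]
      refine ((orderStat_succ_le_iff t han _).1 le_rfl).trans_le (Finset.card_le_card fun i hi => ?_)
      simp only [Finset.mem_filter, Finset.mem_univ, true_and] at hi ⊢
      have : i ∉ midIdx (a + 1) c t := fun hm =>
        absurd (orderStat_lt_of_mem_midIdx hinj ht hm) (not_lt.2 hi)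
      simpa [mask, this] using hi
    · rw [← not_lt, orderStat_succ_lt_iff _ han]
      have h0 := (not_congr (orderStat_succ_lt_iff t han (orderStat t (a + 1)))).1 (lt_irrefl _)
      refine fun hlt => h0 (hlt.trans_le (Finset.card_le_card fun i hi => ?_))
      simp only [Finset.mem_filter, Finset.mem_univ, true_and] at hi ⊢
      refine lt_of_le_of_lt ?_ hi
      unfold mask
      split_ifs
      · exact (ht i).2.le
      · exact le_rfl

lemma orderStat_mask_right {t : Fin n → ℝ} (hinj : Function.Injective t)
    (ht : ∀ i, t i ∈ Set.Ioo (0 : ℝ) 1) {a c : ℕ} (hac : a + 1 < c) (hc : c ≤ n + 1) :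
    orderStat (mask (midIdx a c t) t) (a + 1) = orderStat t c := by
  have han : a < n := by omega
  have hcard := card_midIdx (a := a) hc t
  have hIcc : ∀ i, t i ∈ Set.Icc (0 : ℝ) 1 := fun i => Set.Ioo_subset_Icc_self (ht i)
  obtain ⟨d, rfl⟩ : ∃ d, c = d + 1 := ⟨c - 1, by omega⟩
  set T := midIdx a (d + 1) t with hT
  have hTlt : ∀ i ∈ T, t i < orderStat t (d + 1) := fun i hi =>
    lt_orderStat_of_mem_midIdx hinj ht hc hi
  have hle1 : orderStat t (d + 1) ≤ 1 := (orderStat_mem_Icc hIcc _).2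
  apply le_antisymm
  · rw [orderStat_succ_le_iff _ han]
    rcases Nat.lt_or_ge d n with hdn | hdn
    · have h1 := (orderStat_succ_le_iff t hdn _).1 le_rfl
      have h2 : ((Finset.univ.filter fun i => t i ≤ orderStat t (d + 1)) \ T).card ≤
          (Finset.univ.filter fun i => mask T t i ≤ orderStat t (d + 1)).card := by
        refine Finset.card_le_card fun i hi => ?_
        simp only [Finset.mem_sdiff, Finset.mem_filter, Finset.mem_univ, true_and] at hi ⊢
        simpa [mask, hi.2] using hi.1
      have h3 := Finset.le_card_sdiff T (Finset.univ.filter fun i => t i ≤ orderStat t (d + 1))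
      omega
    · obtain rfl : d = n := by omega
      rw [orderStat_last]
      have : (Finset.univ.filter fun i => mask T t i ≤ 1) = Finset.univ := by
        refine Finset.filter_true_of_mem fun i _ => ?_
        unfold mask
        split_ifs
        · exact le_rfl
        · exact (ht i).2.le
      rw [this]
      simpa using han
  · rw [← not_lt, orderStat_succ_lt_iff _ han, not_lt]
    have h2 : (Finset.univ.filter fun i => mask T t i < orderStat t (d + 1)) ⊆
        (Finset.univ.filter fun i => t i < orderStat t (d + 1)) \ T := by
      intro i hi
      simp only [Finset.mem_sdiff, Finset.mem_filter, Finset.mem_univ, true_and] at hi ⊢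
      have hiT : i ∉ T := fun h => by
        simp only [mask, h, if_true] at hi
        linarith
      exact ⟨by simpa [mask, hiT] using hi, hiT⟩
    have h3 : T ⊆ (Finset.univ.filter fun i => t i < orderStat t (d + 1)) := fun i hi => by
      simpa using hTlt i hi
    have h4 : (Finset.univ.filter fun i => t i < orderStat t (d + 1)).card ≤ d := by
      rcases Nat.lt_or_ge d n with hdn | hdn
      · exact not_lt.1 ((not_congr (orderStat_succ_lt_iff t hdn _)).1 (lt_irrefl _))
      · refine (Finset.card_filter_le _ _).trans ?_
        simpa using hdn
    have h5 := Finset.card_le_card h2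
    rw [Finset.card_sdiff_of_subset h3] at h5
    omega

/-- For tuples without ties, `T` is the set of indices with rank strictly between `a` and `c`
if and only if the points with index in `T` lie between two consecutive order statistics of the
other points. -/
lemma midIdx_eq_iff {t : Fin n → ℝ} (hinj : Function.Injective t)
    (ht : ∀ i, t i ∈ Set.Ioo (0 : ℝ) 1) {a c : ℕ} (hac : a + 1 < c) (hc : c ≤ n + 1)
    {T : Finset (Fin n)} (hT : T.card = c - 1 - a) :
    midIdx a c t = T ↔
      ∀ i ∈ T, t i ∈ Set.Ioo (orderStat (mask T t) a) (orderStat (mask T t) (a + 1)) := by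
  constructor
  · rintro rfl i hi
    rw [orderStat_mask_left hinj ht hac hc, orderStat_mask_right hinj ht hac hc]
    exact ⟨orderStat_lt_of_mem_midIdx hinj ht hi, lt_orderStat_of_mem_midIdx hinj ht hc hi⟩
  · intro h
    symm
    refine Finset.eq_of_subset_of_card_le (fun i hi => ?_) (by rw [card_midIdx hc, hT])
    rw [mem_midIdx_iff hinj]
    obtain ⟨h1, h2⟩ := h i hi
    have han : a < n := by omega
    have hsplit : (Finset.univ.filter fun r => t r < t i) =
        (Finset.univ.filter fun r => mask T t r < t i) ∪ T.filter fun r => t r < t i := by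
      ext r
      simp only [Finset.mem_union, Finset.mem_filter, Finset.mem_univ, true_and]
      by_cases hr : r ∈ T
      · simp [mask, hr, (ht i).2.le]
      · simp [mask, hr]
    have hdisj : Disjoint (Finset.univ.filter fun r => mask T t r < t i)
        (T.filter fun r => t r < t i) := by
      rw [Finset.disjoint_left]
      intro r hr hr'
      have hrT := (Finset.mem_filter.1 hr').1
      simp only [Finset.mem_filter, Finset.mem_univ, true_and] at hr
      simp only [mask, hrT, if_true] at hr
      exact absurd hr (not_lt.2 (ht i).2.le)
    have hTc : (T.filter fun r => t r < t i).card < T.card :=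
      Finset.card_lt_card (Finset.filter_ssubset.2 ⟨i, hi, lt_irrefl _⟩)
    have hup : (Finset.univ.filter fun r => mask T t r < t i).card ≤ a :=
      not_lt.1 ((not_congr (orderStat_succ_lt_iff _ han _)).1 h2.not_gt)
    have hlow : a ≤ (Finset.univ.filter fun r => mask T t r < t i).card := by
      cases a with
      | zero => exact Nat.zero_le _
      | succ a => exact (orderStat_succ_lt_iff _ (by omega) _).1 h1
    rw [hsplit, Finset.card_union_of_disjoint hdisj]
    omega

lemma binMean_eq (B : ℕ) (t y : Fin n → ℝ) (b : Fin B) :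
    binMean B t y b = (∑ i ∈ midIdx (binCut n B b) (binCut n B ((b : ℕ) + 1)) t, y i) /
      ((midIdx (binCut n B b) (binCut n B ((b : ℕ) + 1)) t).card : ℝ) := by
  simp only [binMean, midIdx, binPositions, Finset.sum_map, Finset.card_map, Equiv.coe_toEmbedding]

/-! ### Bins -/

lemma binCut_zero (n B : ℕ) : binCut n B 0 = 0 := by simp [binCut]

lemma binCut_last {B : ℕ} (hB : 0 < B) : binCut n B B = n + 1 := by
  have : (B : ℚ) ≠ 0 := by positivity
  rw [binCut, mul_div_assoc, mul_div_cancel₀ _ this]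
  exact_mod_cast Nat.ceil_natCast (n + 1)

lemma binCut_mono (n B : ℕ) : Monotone (binCut n B) := fun a b h => by
  unfold binCut
  gcongr

lemma binCut_le {B b : ℕ} (hb : b ≤ B) : binCut n B b ≤ n + 1 := by
  rcases Nat.eq_zero_or_pos B with rfl | hB
  · simp [binCut]
  · exact (binCut_mono n B hb).trans (binCut_last hB).le

lemma binCut_add_le {k : ℕ} (hk : 0 < k) (hkn : k ≤ n) (b : ℕ) :
    binCut n (n / k) b + k ≤ binCut n (n / k) (b + 1) := by
  have hB : 0 < n / k := Nat.div_pos hkn hk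
  unfold binCut
  rw [← Nat.ceil_add_natCast (by positivity)]
  refine Nat.ceil_mono ?_
  have hB' : (0 : ℚ) < (n / k : ℕ) := by exact_mod_cast hB
  have h : (k : ℚ) * (n / k : ℕ) ≤ n := by exact_mod_cast Nat.mul_div_le n k
  rw [div_add' _ _ _ hB'.ne', div_le_div_iff_of_pos_right hB']
  push_cast
  linarith

lemma exists_inBin {B : ℕ} (hB : 0 < B) (t : Fin n → ℝ) {s : ℝ} (hs : 0 ≤ s) :
    ∃ b : Fin B, InBin B t b s := by
  classical
  set m := Nat.findGreatest (fun b => orderStat t (binCut n B b) ≤ s) (B - 1) with hm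
  have h0 : orderStat t (binCut n B 0) ≤ s := by rwa [binCut_zero, orderStat_zero]
  have hle : m ≤ B - 1 := Nat.findGreatest_le _
  refine ⟨⟨m, by omega⟩, Nat.findGreatest_spec (P := fun b => orderStat t (binCut n B b) ≤ s)
    (Nat.zero_le _) h0, ?_⟩
  by_cases hmB : m + 1 = B
  · exact Or.inr hmB
  · left
    have := Nat.findGreatest_is_greatest (P := fun b => orderStat t (binCut n B b) ≤ s)
      (n := B - 1) (k := m + 1) (by omega) (by omega)
    exact not_le.1 this

lemma inBin_unique {B : ℕ} {t : Fin n → ℝ} (ht : ∀ i, t i ∈ Set.Icc (0 : ℝ) 1) {s : ℝ}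
    {b b' : Fin B} (hb : InBin B t b s) (hb' : InBin B t b' s) : b = b' := by
  have key : ∀ b b' : Fin B, InBin B t b s → InBin B t b' s → ¬ b < b' := by
    intro b b' hb hb' hlt
    have hlt' : (b : ℕ) < b' := hlt
    rcases hb.2 with h | h
    · have := orderStat_mono ht (binCut_mono n B (show (b : ℕ) + 1 ≤ b' by omega))
      exact absurd hb'.1 (not_le.2 (h.trans_le this))
    · have := b'.2
      omega
  exact le_antisymm (not_lt.1 (key _ _ hb' hb)) (not_lt.1 (key _ _ hb hb'))

end OrderStatistics

/-! ### Measurability -/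

section Measurability

variable {n : ℕ}

lemma measurableSet_sort_eq (τ : Equiv.Perm (Fin n)) :
    MeasurableSet {t : Fin n → ℝ | Tuple.sort t = τ} := by
  have : {t : Fin n → ℝ | Tuple.sort t = τ} =
      {t | (∀ i j, i ≤ j → t (τ i) ≤ t (τ j)) ∧
        ∀ i j, i < j → t (τ i) = t (τ j) → τ i < τ j} := by
    ext t
    rw [Set.mem_ofPred_eq, eq_comm, Tuple.eq_sort_iff]
    rfl
  rw [this]
  refine measurableSet_setOfPred.2 (Measurable.and ?_ ?_)
  · refine Measurable.forall fun i => Measurable.forall fun j => Measurable.imp measurable_const ?_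
    exact measurableSet_setOfPred.1
      (measurableSet_le (measurable_pi_apply _) (measurable_pi_apply _))
  · refine Measurable.forall fun i => Measurable.forall fun j => Measurable.imp measurable_const
      (Measurable.imp ?_ measurable_const)
    exact measurableSet_setOfPred.1
      (measurableSet_eq_fun (measurable_pi_apply _) (measurable_pi_apply _))

/-- A function that depends measurably on a tuple and arbitrarily on the permutation that sorts
it is measurable. -/
lemma measurable_of_sort {α β : Type*} [MeasurableSpace α] [MeasurableSpace β]
    {t : α → Fin n → ℝ} (ht : Measurable t) {F : Equiv.Perm (Fin n) → α → β}
    (hF : ∀ τ, Measurable (F τ)) : Measurable fun x => F (Tuple.sort (t x)) x := by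
  let : MeasurableSpace (Equiv.Perm (Fin n)) := ⊤
  have : DiscreteMeasurableSpace (Equiv.Perm (Fin n)) := ⟨fun _ => trivial⟩
  have h1 : Measurable fun x => Tuple.sort (t x) :=
    measurable_to_countable' fun τ => ht (measurableSet_sort_eq τ)
  have h2 : Measurable fun p : Equiv.Perm (Fin n) × α => F p.1 p.2 :=
    measurable_from_prod_countable_right hF
  exact h2.comp (h1.prodMk measurable_id)

lemma measurable_orderStat (j : ℕ) : Measurable fun t : Fin n → ℝ => orderStat t j := by
  cases j with
  | zero => exact measurable_const
  | succ j =>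
    by_cases h : j < n
    · simp only [orderStat, h, dif_pos]
      exact measurable_of_sort (F := fun τ (t : Fin n → ℝ) => t (τ ⟨j, h⟩)) measurable_id
        fun τ => measurable_pi_apply _
    · simp only [orderStat, h, dif_neg, not_false_eq_true]
      exact measurable_const

lemma measurable_binMean (B : ℕ) (b : Fin B) :
    Measurable fun p : (Fin n → ℝ) × (Fin n → ℝ) => binMean B p.1 p.2 b :=
  measurable_of_sort (F := fun τ (p : (Fin n → ℝ) × (Fin n → ℝ)) =>
    (∑ i ∈ binPositions n B b, p.2 (τ i)) / ((binPositions n B b).card : ℝ)) measurable_fst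
    fun τ => by fun_prop

lemma measurableSet_midIdx_eq (a c : ℕ) (T : Finset (Fin n)) :
    MeasurableSet {t : Fin n → ℝ | midIdx a c t = T} := by
  let : MeasurableSpace (Finset (Fin n)) := ⊤
  have : Measurable fun t : Fin n → ℝ => midIdx a c t :=
    measurable_of_sort (F := fun τ (_ : Fin n → ℝ) =>
      (Finset.univ.filter fun i : Fin n => a < (i : ℕ) + 1 ∧ (i : ℕ) + 1 < c).map τ.toEmbedding)
      measurable_id fun τ => measurable_const
  exact this (show MeasurableSet {T} from trivial)

lemma measurableSet_inBin {B : ℕ} (b : Fin B) :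
    MeasurableSet {p : (Fin n → ℝ) × ℝ | InBin B p.1 b p.2} := by
  refine MeasurableSet.inter ?_ (MeasurableSet.union ?_ (MeasurableSet.const _))
  · exact measurableSet_le ((measurable_orderStat _).comp measurable_fst) measurable_snd
  · exact measurableSet_lt measurable_snd ((measurable_orderStat _).comp measurable_fst)

end Measurability

/-! ### Conditioning on the end points of a bin -/

section Conditioning

open scoped ENNReal

variable {n : ℕ}

/-- The scores of a sample of (score, label) pairs. -/
def scores (x : Fin n → ℝ × ℝ) : Fin n → ℝ := fun i => (x i).1

/-- The labels of a sample of (score, label) pairs. -/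
def labels (x : Fin n → ℝ × ℝ) : Fin n → ℝ := fun i => (x i).2

@[fun_prop]
lemma measurable_scores : Measurable (scores (n := n)) := by
  unfold scores; fun_prop

@[fun_prop]
lemma measurable_labels : Measurable (labels (n := n)) := by
  unfold labels; fun_prop

/-- The (score, label) pairs with score strictly between `lo` and `hi`. -/
def strip (lo hi : ℝ) : Set (ℝ × ℝ) := {p | p.1 ∈ Set.Ioo lo hi}

lemma measurableSet_strip (lo hi : ℝ) : MeasurableSet (strip lo hi) :=
  measurable_fst measurableSet_Ioo

/-- The sample has pairwise different scores, all of them in `(0,1)`. -/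
def NoTies (x : Fin n → ℝ × ℝ) : Prop :=
  Function.Injective (scores x) ∧ ∀ i, scores x i ∈ Set.Ioo (0 : ℝ) 1

lemma lintegral_eq_sum_midIdx (μ : Measure (Fin n → ℝ × ℝ)) (a c : ℕ)
    {f : (Fin n → ℝ × ℝ) → ℝ≥0∞} (hf : Measurable f) :
    ∫⁻ x, f x ∂μ = ∑ T : Finset (Fin n), ∫⁻ x in {x | midIdx a c (scores x) = T}, f x ∂μ := by
  have hT : ∀ T : Finset (Fin n), MeasurableSet {x | midIdx a c (scores x) = T} := fun T =>
    measurable_scores (measurableSet_midIdx_eq a c T)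
  simp_rw [← lintegral_indicator (hT _)]
  rw [← lintegral_finsetSum _ fun T _ => hf.indicator (hT T)]
  refine lintegral_congr fun x => ?_
  rw [Finset.sum_eq_single (midIdx a c (scores x))]
  · simp
  · intro T _ hne
    simp [hne.symm]
  · simp

/-- If a bound for the average over an i.i.d. sample from `Q` that falls into the strip between
`lo` and `hi` holds for all `lo` and `hi`, then it holds for the sample points between
two order statistics. -/
lemma lintegral_between_orderStat_le (Q : Measure (ℝ × ℝ)) [IsProbabilityMeasure Q]
    (hties : ∀ᵐ x ∂(Measure.pi fun _ : Fin n => Q), NoTies x)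
    {a c : ℕ} (hac : a + 1 < c) (hc : c ≤ n + 1)
    {w : ℝ → ℝ → ℝ≥0∞} (hw : Measurable fun p : ℝ × ℝ => w p.1 p.2)
    {Ψ : ℝ → ℝ → ℝ → ℝ≥0∞} (hΨ : Measurable fun p : ℝ × ℝ × ℝ => Ψ p.1 p.2.1 p.2.2)
    {C : ℝ≥0∞}
    (hC : ∀ T : Finset (Fin n), T.card = c - 1 - a → ∀ lo hi,
      ∫⁻ u in Set.univ.pi fun _ : {i // i ∈ T} => strip lo hi,
        Ψ lo hi ((∑ i, (u i).2) / (T.card : ℝ)) ∂(Measure.pi fun _ => Q) ≤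
      C * (Measure.pi fun _ : {i // i ∈ T} => Q) (Set.univ.pi fun _ => strip lo hi)) :
    ∫⁻ x, w (orderStat (scores x) a) (orderStat (scores x) c) *
        Ψ (orderStat (scores x) a) (orderStat (scores x) c)
          ((∑ i ∈ midIdx a c (scores x), labels x i) / ((midIdx a c (scores x)).card : ℝ))
        ∂(Measure.pi fun _ : Fin n => Q) ≤
      C * ∫⁻ x, w (orderStat (scores x) a) (orderStat (scores x) c)
        ∂(Measure.pi fun _ : Fin n => Q) := by
  set μ := Measure.pi fun _ : Fin n => Q with hμ
  have hos : ∀ j, Measurable fun x : Fin n → ℝ × ℝ => orderStat (scores x) j := fun j =>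
    (measurable_orderStat j).comp measurable_scores
  have hmean : Measurable fun x : Fin n → ℝ × ℝ =>
      (∑ i ∈ midIdx a c (scores x), labels x i) / ((midIdx a c (scores x)).card : ℝ) :=
    measurable_of_sort (F := fun τ (x : Fin n → ℝ × ℝ) =>
      (∑ i ∈ ((Finset.univ.filter fun i : Fin n => a < (i : ℕ) + 1 ∧ (i : ℕ) + 1 < c).map
        τ.toEmbedding), labels x i) / ((((Finset.univ.filter fun i : Fin n =>
          a < (i : ℕ) + 1 ∧ (i : ℕ) + 1 < c).map τ.toEmbedding).card : ℕ) : ℝ))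
      measurable_scores fun τ => by unfold labels; fun_prop
  have hwx : Measurable fun x : Fin n → ℝ × ℝ =>
      w (orderStat (scores x) a) (orderStat (scores x) c) := hw.comp ((hos a).prodMk (hos c))
  have hΨx := hΨ.comp ((hos a).prodMk ((hos c).prodMk hmean))
  refine le_of_eq_of_le (lintegral_eq_sum_midIdx μ a c (hwx.mul hΨx)) ?_
  rw [lintegral_eq_sum_midIdx μ a c hwx, Finset.mul_sum]
  refine Finset.sum_le_sum fun T _ => ?_
  by_cases hT : T.card = c - 1 - a
  swap
  · have : {x : Fin n → ℝ × ℝ | midIdx a c (scores x) = T} = ∅ := by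
      ext x
      simp only [Set.mem_ofPred_eq, Set.mem_empty_iff_false, iff_false]
      rintro rfl
      exact hT (card_midIdx hc _)
    simp [this]
  -- the order statistics of the other points
  let e := MeasurableEquiv.piEquivPiSubtypeProd (fun _ : Fin n => ℝ × ℝ) (fun i => i ∈ T)
  let rest : ({i // i ∉ T} → ℝ × ℝ) → Fin n → ℝ := fun z i => if h : i ∈ T then 1 else (z ⟨i, h⟩).1
  have hrest : Measurable rest := by
    refine measurable_pi_lambda _ fun i => ?_
    by_cases h : i ∈ T
    · simp only [rest, h, dif_pos]; exact measurable_const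
    · simp only [rest, h, dif_neg, not_false_eq_true]; fun_prop
  have hmask : ∀ x, mask T (scores x) = rest (e x).2 := fun x => by
    ext i
    by_cases h : i ∈ T <;> simp [mask, rest, scores, e, h, MeasurableEquiv.piEquivPiSubtypeProd]
  let lo : ({i // i ∉ T} → ℝ × ℝ) → ℝ := fun z => orderStat (rest z) a
  let hi : ({i // i ∉ T} → ℝ × ℝ) → ℝ := fun z => orderStat (rest z) (a + 1)
  have hlo : Measurable lo := (measurable_orderStat a).comp hrest
  have hhi : Measurable hi := (measurable_orderStat (a + 1)).comp hrest
  let S : Set (({i // i ∈ T} → ℝ × ℝ) × ({i // i ∉ T} → ℝ × ℝ)) :=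
    {p | ∀ i, p.1 i ∈ strip (lo p.2) (hi p.2)}
  have hS : MeasurableSet S := by
    refine measurableSet_setOfPred.2 (Measurable.forall fun i => ?_)
    refine measurableSet_setOfPred.1 (MeasurableSet.inter ?_ ?_)
    · exact measurableSet_lt (hlo.comp measurable_snd) (by fun_prop : Measurable fun p :
        ({i // i ∈ T} → ℝ × ℝ) × ({i // i ∉ T} → ℝ × ℝ) => (p.1 i).1)
    · exact measurableSet_lt (by fun_prop : Measurable fun p :
        ({i // i ∈ T} → ℝ × ℝ) × ({i // i ∉ T} → ℝ × ℝ) => (p.1 i).1) (hhi.comp measurable_snd)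
  have he : MeasurePreserving e μ
      ((Measure.pi fun _ => Q).prod (Measure.pi fun _ => Q)) := by
    convert measurePreserving_piEquivPiSubtypeProd (fun _ : Fin n => Q) (fun i => i ∈ T)
  have hAS : {x : Fin n → ℝ × ℝ | midIdx a c (scores x) = T} =ᵐ[μ] e ⁻¹' S := by
    filter_upwards [hties] with x hx
    refine propext ?_
    refine (midIdx_eq_iff hx.1 hx.2 hac hc hT).trans ?_
    rw [hmask]
    exact ⟨fun h i => h i i.2, fun h i hi => h ⟨i, hi⟩⟩
  let F : ({i // i ∈ T} → ℝ × ℝ) × ({i // i ∉ T} → ℝ × ℝ) → ℝ≥0∞ := fun p =>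
    w (lo p.2) (hi p.2) * Ψ (lo p.2) (hi p.2) ((∑ i, (p.1 i).2) / (T.card : ℝ))
  let W : ({i // i ∈ T} → ℝ × ℝ) × ({i // i ∉ T} → ℝ × ℝ) → ℝ≥0∞ := fun p =>
    w (lo p.2) (hi p.2)
  have hW : Measurable W := by
    exact hw.comp ((hlo.comp measurable_snd).prodMk (hhi.comp measurable_snd))
  have hΨu : Measurable fun p : ({i // i ∈ T} → ℝ × ℝ) × ({i // i ∉ T} → ℝ × ℝ) =>
      Ψ (lo p.2) (hi p.2) ((∑ i, (p.1 i).2) / (T.card : ℝ)) :=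
    hΨ.comp ((hlo.comp measurable_snd).prodMk ((hhi.comp measurable_snd).prodMk (by fun_prop)))
  have hF : Measurable F := hW.mul hΨu
  have hends : ∀ x, NoTies x → midIdx a c (scores x) = T →
      orderStat (scores x) a = lo (e x).2 ∧ orderStat (scores x) c = hi (e x).2 := by
    intro x hx hxT
    simp only [lo, hi]
    rw [← hmask, ← hxT]
    exact ⟨(orderStat_mask_left hx.1 hx.2 hac hc).symm, (orderStat_mask_right hx.1 hx.2 hac hc).symm⟩
  have hA : MeasurableSet {x : Fin n → ℝ × ℝ | midIdx a c (scores x) = T} :=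
    measurable_scores (measurableSet_midIdx_eq a c T)
  have h1 : ∫⁻ x in {x : Fin n → ℝ × ℝ | midIdx a c (scores x) = T},
      w (orderStat (scores x) a) (orderStat (scores x) c) *
        Ψ (orderStat (scores x) a) (orderStat (scores x) c)
          ((∑ i ∈ midIdx a c (scores x), labels x i) / ((midIdx a c (scores x)).card : ℝ)) ∂μ =
      ∫⁻ p in S, F p ∂((Measure.pi fun _ => Q).prod (Measure.pi fun _ => Q)) := by
    rw [← he.setLIntegral_comp_preimage hS hF, ← setLIntegral_congr hAS]
    refine setLIntegral_congr_fun_ae hA ?_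
    filter_upwards [hties] with x hx hxT
    obtain ⟨h1, h2⟩ := hends x hx hxT
    have h3 : ∑ i ∈ T, labels x i = ∑ i, ((e x).1 i).2 :=
      (Finset.sum_coe_sort T (fun i => labels x i)).symm
    rw [h1, h2, show midIdx a c (scores x) = T from hxT, h3]
  have h2 : ∫⁻ x in {x : Fin n → ℝ × ℝ | midIdx a c (scores x) = T},
      w (orderStat (scores x) a) (orderStat (scores x) c) ∂μ =
      ∫⁻ p in S, W p ∂((Measure.pi fun _ => Q).prod (Measure.pi fun _ => Q)) := by
    rw [← he.setLIntegral_comp_preimage hS hW, ← setLIntegral_congr hAS]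
    refine setLIntegral_congr_fun_ae hA ?_
    filter_upwards [hties] with x hx hxT
    obtain ⟨h1, h2⟩ := hends x hx hxT
    rw [h1, h2]
  have hslice : ∀ z, {u | (u, z) ∈ S} = Set.univ.pi fun _ : {i // i ∈ T} => strip (lo z) (hi z) :=
    fun z => by ext u; simp [S]
  have hpi : ∀ z, MeasurableSet (Set.univ.pi fun _ : {i // i ∈ T} => strip (lo z) (hi z)) :=
    fun z => MeasurableSet.univ_pi fun _ => measurableSet_strip _ _
  have hinner : ∀ (G : ({i // i ∈ T} → ℝ × ℝ) × ({i // i ∉ T} → ℝ × ℝ) → ℝ≥0∞) (z),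
      ∫⁻ u in Set.univ.pi (fun _ : {i // i ∈ T} => strip (lo z) (hi z)), G (u, z)
        ∂(Measure.pi fun _ => Q) = ∫⁻ u, S.indicator G (u, z) ∂(Measure.pi fun _ => Q) := by
    intro G z
    rw [← lintegral_indicator (hpi z)]
    refine lintegral_congr fun u => ?_
    rw [← hslice z]
    rfl
  have hind : ∀ (G : ({i // i ∈ T} → ℝ × ℝ) × ({i // i ∉ T} → ℝ × ℝ) → ℝ≥0∞), Measurable G →
      ∫⁻ p in S, G p ∂((Measure.pi fun _ => Q).prod (Measure.pi fun _ => Q)) =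
      ∫⁻ z, ∫⁻ u in Set.univ.pi (fun _ : {i // i ∈ T} => strip (lo z) (hi z)), G (u, z)
        ∂(Measure.pi fun _ => Q) ∂(Measure.pi fun _ => Q) := by
    intro G hG
    rw [← lintegral_indicator hS, lintegral_prod_symm' _ (hG.indicator hS)]
    exact lintegral_congr fun z => (hinner G z).symm
  refine h1.le.trans (le_of_le_of_eq ?_ (congrArg (C * ·) h2.symm))
  rw [hind F hF, hind W hW, ← lintegral_const_mul]
  · refine lintegral_mono fun z => ?_
    simp only [F, W]
    have hm : Measurable fun u : {i // i ∈ T} → ℝ × ℝ =>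
        Ψ (lo z) (hi z) ((∑ i, (u i).2) / (T.card : ℝ)) :=
      hΨ.comp (measurable_const.prodMk (measurable_const.prodMk (by fun_prop)))
    rw [lintegral_const_mul _ hm, setLIntegral_const]
    have h4 := hC T hT (lo z) (hi z)
    generalize (Measure.pi fun _ : {i // i ∈ T} => Q)
      (Set.univ.pi fun _ => strip (lo z) (hi z)) = m at h4 ⊢
    calc _ ≤ w (lo z) (hi z) * (C * m) := mul_le_mul_right h4 _
      _ = C * (w (lo z) (hi z) * m) := mul_left_comm _ _ _
  · simp_rw [hinner W]
    exact (hW.indicator hS).lintegral_prod_left'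

end Conditioning

/-! ### Concentration of the mean of an i.i.d. sample -/

section Concentration

open scoped ENNReal

variable {ι : Type*} [Fintype ι] {Ω : Type*} [MeasurableSpace Ω]

lemma setLIntegral_pi_le_of_cond [Nonempty ι] (Q : Measure Ω) [IsProbabilityMeasure Q]
    {S : Set Ω} {f : (ι → Ω) → ℝ≥0∞} {C : ℝ≥0∞}
    (h : Q S ≠ 0 → ∫⁻ u, f u ∂(Measure.pi fun _ => Q[|S]) ≤ C) :
    ∫⁻ u in Set.univ.pi fun _ : ι => S, f u ∂(Measure.pi fun _ => Q) ≤
      C * (Measure.pi fun _ : ι => Q) (Set.univ.pi fun _ => S) := by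
  by_cases h0 : Q S = 0
  · have : (Measure.pi fun _ : ι => Q) (Set.univ.pi fun _ => S) = 0 := by
      simp [Measure.pi_pi, h0]
    rw [setLIntegral_measure_zero _ _ this]
    exact zero_le
  · have : IsProbabilityMeasure Q[|S] := cond_isProbabilityMeasure h0
    have h1 : Q.restrict S = Q S • Q[|S] := by
      rw [ProbabilityTheory.cond, smul_smul, ENNReal.mul_inv_cancel h0 (measure_ne_top _ _),
        one_smul]
    have h2 : (Measure.pi fun _ : ι => Q).restrict (Set.univ.pi fun _ => S) =
        (Q S ^ Fintype.card ι) • Measure.pi fun _ => Q[|S] := by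
      rw [Measure.restrict_pi_pi]
      refine Measure.pi_eq fun s _ => ?_
      simp [h1, Measure.pi_pi, Finset.prod_mul_distrib]
    rw [h2, lintegral_smul_measure, Measure.pi_pi, Finset.prod_const, Finset.card_univ,
      smul_eq_mul, mul_comm]
    exact mul_le_mul_left (h h0) _

variable {ν : Measure Ω} [IsProbabilityMeasure ν] {y : Ω → ℝ}

lemma measureReal_sum_ge_le {a b : ℝ} (hab : b - a = 1) (hy : Measurable y)
    (hab' : ∀ᵐ p ∂ν, y p ∈ Set.Icc a b) {ε : ℝ} (hε : 0 ≤ ε) :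
    (Measure.pi fun _ : ι => ν).real
        {u | Fintype.card ι * ε ≤ ∑ i, (y (u i) - ∫ p, y p ∂ν)} ≤
      Real.exp (-(2 * Fintype.card ι * ε ^ 2)) := by
  have hindep : iIndepFun (fun (i : ι) (u : ι → Ω) => y (u i) - ∫ p, y p ∂ν)
      (Measure.pi fun _ : ι => ν) :=
    iIndepFun_pi (μ := fun _ : ι => ν) (X := fun _ p => y p - ∫ p, y p ∂ν)
      fun _ => (hy.sub_const _).aemeasurable
  have hsub : ∀ i ∈ (Finset.univ : Finset ι),
      HasSubgaussianMGF (fun u : ι → Ω => y (u i) - ∫ p, y p ∂ν) ((‖b - a‖₊ / 2) ^ 2)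
        (Measure.pi fun _ : ι => ν) := by
    intro i _
    have hmp := measurePreserving_eval (fun _ : ι => ν) i
    have := hasSubgaussianMGF_of_mem_Icc (μ := Measure.pi fun _ : ι => ν)
      (X := fun u => y (u i)) (hy.comp (measurable_pi_apply i)).aemeasurable
      (hmp.quasiMeasurePreserving.ae hab')
    have hint : ∫ u, y (u i) ∂(Measure.pi fun _ : ι => ν) = ∫ p, y p ∂ν := by
      conv_rhs => rw [← hmp.map_eq]
      exact (integral_map hmp.measurable.aemeasurable hy.aestronglyMeasurable).symm
    rwa [hint] at this
  refine (HasSubgaussianMGF.measure_sum_ge_le_of_iIndepFun hindep hsub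
    (by positivity : 0 ≤ Fintype.card ι * ε)).trans (Real.exp_le_exp.2 (le_of_eq ?_))
  rcases Nat.eq_zero_or_pos (Fintype.card ι) with h | h
  · simp [h]
  · have h' : (Fintype.card ι : ℝ) ≠ 0 := by positivity
    rw [hab]
    simp only [nnnorm_one, Finset.sum_const, Finset.card_univ, nsmul_eq_mul]
    push_cast
    field_simp

/-- Hoeffding's inequality for the mean of an i.i.d. sample of `[0,1]`-valued variables. -/
lemma measure_mean_gt_le [Nonempty ι] (hy : Measurable y) (hy' : ∀ᵐ p ∂ν, y p ∈ Set.Icc 0 1)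
    {ε : ℝ} (hε : 0 ≤ ε) :
    (Measure.pi fun _ : ι => ν)
        {u | ε < |(∑ i, y (u i)) / (Fintype.card ι : ℝ) - ∫ p, y p ∂ν|} ≤
      ENNReal.ofReal (2 * Real.exp (-(2 * Fintype.card ι * ε ^ 2))) := by
  have h1 := measureReal_sum_ge_le (ι := ι) (by norm_num) hy hy' hε
  have h2 := measureReal_sum_ge_le (ι := ι) (a := -1) (b := 0) (y := fun p => -y p) (by norm_num)
    hy.neg (hy'.mono fun p hp => ⟨by linarith [hp.2], by linarith [hp.1]⟩) hε
  rw [← ofReal_measureReal (measure_ne_top _ _)]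
  refine ENNReal.ofReal_le_ofReal ((measureReal_mono ?_).trans
    ((measureReal_union_le _ _).trans ((add_le_add h1 h2).trans_eq (two_mul _).symm)))
  intro u hu
  have hN : (0 : ℝ) < Fintype.card ι := by exact_mod_cast Fintype.card_pos
  have hs : (∑ i, y (u i)) / (Fintype.card ι : ℝ) - ∫ p, y p ∂ν =
      (∑ i, (y (u i) - ∫ p, y p ∂ν)) / Fintype.card ι := by
    rw [Finset.sum_sub_distrib, Finset.sum_const, Finset.card_univ, nsmul_eq_mul]
    field_simp
  rw [Set.mem_ofPred_eq, hs, lt_abs, ← neg_div, lt_div_iff₀' hN, lt_div_iff₀' hN] at hu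
  rcases hu with hu | hu
  · exact Or.inl hu.le
  · right
    rw [Set.mem_ofPred_eq, integral_neg]
    refine hu.le.trans_eq ?_
    rw [← Finset.sum_neg_distrib]
    exact Finset.sum_congr rfl fun i _ => by ring

lemma lintegral_abs_mean_sub_le [Nonempty ι] (hy : Measurable y)
    (hy' : ∀ᵐ p ∂ν, y p ∈ Set.Icc 0 1) :
    ∫⁻ u, ENNReal.ofReal |(∑ i, y (u i)) / (Fintype.card ι : ℝ) - ∫ p, y p ∂ν|
        ∂(Measure.pi fun _ : ι => ν) ≤
      ENNReal.ofReal √(1 / (4 * Fintype.card ι)) := by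
  set μ := Measure.pi fun _ : ι => ν
  have hN : (0 : ℝ) < Fintype.card ι := by exact_mod_cast Fintype.card_pos
  have hmem : ∀ i, ∀ᵐ u ∂μ, y (u i) ∈ Set.Icc (0 : ℝ) 1 := fun i =>
    (measurePreserving_eval (fun _ : ι => ν) i).quasiMeasurePreserving.ae hy'
  have hLp : ∀ i, MemLp (fun u : ι → Ω => y (u i)) 2 μ := fun i =>
    memLp_of_bounded (hmem i) (hy.comp (measurable_pi_apply i)).aestronglyMeasurable 2
  have hint : ∀ i, ∫ u, y (u i) ∂μ = ∫ p, y p ∂ν := fun i => by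
    have hmp := measurePreserving_eval (fun _ : ι => ν) i
    conv_rhs => rw [← hmp.map_eq]
    exact (integral_map hmp.measurable.aemeasurable hy.aestronglyMeasurable).symm
  let S : (ι → Ω) → ℝ := ∑ i, fun u => y (u i)
  have hS : MemLp S 2 μ := memLp_finsetSum' _ fun i _ => hLp i
  have hindep : iIndepFun (fun (i : ι) (u : ι → Ω) => y (u i)) μ :=
    iIndepFun_pi (μ := fun _ : ι => ν) (X := fun _ p => y p) fun _ => hy.aemeasurable
  have hvar : variance S μ ≤ Fintype.card ι / 4 := by
    rw [IndepFun.variance_sum (fun i _ => hLp i) fun i _ j _ hij => hindep.indepFun hij]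
    calc ∑ i, variance (fun u : ι → Ω => y (u i)) μ ≤ ∑ _i : ι, ((1 - 0) / 2 : ℝ) ^ 2 :=
          Finset.sum_le_sum fun i _ => variance_le_sq_of_bounded (hmem i)
            (hy.comp (measurable_pi_apply i)).aemeasurable
      _ = Fintype.card ι / 4 := by
          rw [Finset.sum_const, Finset.card_univ, nsmul_eq_mul]; ring
  have hES : ∫ u, S u ∂μ = Fintype.card ι * ∫ p, y p ∂ν := by
    simp only [S, Finset.sum_apply]
    rw [integral_finsetSum _ fun i _ => (hLp i).integrable one_le_two]
    simp [hint]
  have hX : MemLp (fun u => S u / Fintype.card ι - ∫ p, y p ∂ν) 2 μ := by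
    simp_rw [div_eq_inv_mul]
    exact (hS.const_mul _).sub (memLp_const _)
  have hsq : ∫ u, (S u / Fintype.card ι - ∫ p, y p ∂ν) ^ 2 ∂μ ≤ 1 / (4 * Fintype.card ι) := by
    have h1 : ∀ u, (S u / Fintype.card ι - ∫ p, y p ∂ν) ^ 2 =
        ((Fintype.card ι : ℝ)⁻¹) ^ 2 * (S u - ∫ u, S u ∂μ) ^ 2 := fun u => by
      rw [hES]; field_simp
    simp_rw [h1]
    rw [integral_const_mul, ← variance_eq_integral hS.aemeasurable]
    calc _ ≤ ((Fintype.card ι : ℝ)⁻¹) ^ 2 * (Fintype.card ι / 4) := by gcongr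
      _ = _ := by field_simp
  have habs : ∫ u, |S u / Fintype.card ι - ∫ p, y p ∂ν| ∂μ ≤ √(1 / (4 * Fintype.card ι)) := by
    refine Real.le_sqrt_of_sq_le (le_trans ?_ hsq)
    have h2 := variance_nonneg (fun u => |S u / Fintype.card ι - ∫ p, y p ∂ν|) μ
    have hXa : MemLp (fun u => |S u / Fintype.card ι - ∫ p, y p ∂ν|) 2 μ := hX.abs
    rw [variance_eq_sub hXa] at h2
    simp only [Pi.pow_apply, sq_abs] at h2
    linarith
  have hSu : ∀ u, ∑ i, y (u i) = S u := fun u => by simp [S]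
  simp_rw [hSu]
  rw [← ofReal_integral_eq_lintegral_ofReal (hX.integrable one_le_two).abs
    (Filter.Eventually.of_forall fun _ => abs_nonneg _)]
  exact ENNReal.ofReal_le_ofReal habs

end Concentration

/-! ### Histogram binning for a law of (score, label) pairs -/

section AbstractBinning

open scoped ENNReal

/-- For a pair `(s, y) ∼ Q`, the conditional probability of `y = 1` given that `s` is strictly
between `lo` and `hi`. -/
noncomputable def stripProb (Q : Measure (ℝ × ℝ)) (lo hi : ℝ) : ℝ :=
  Q.real (strip lo hi ∩ {p | p.2 = 1}) / Q.real (strip lo hi)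

/-- A law of (score, label) pairs with a continuous score in `[0,1]` and a label in `{0,1}`. -/
structure IsScoreLaw (Q : Measure (ℝ × ℝ)) : Prop where
  score_mem : ∀ᵐ p ∂Q, p.1 ∈ Set.Icc (0 : ℝ) 1
  label_mem : ∀ᵐ p ∂Q, p.2 = 0 ∨ p.2 = 1
  noAtom : ∀ v : ℝ, Q {p | p.1 = v} = 0

variable {n : ℕ}

/-- The left end point of bin `b`. -/
noncomputable def binLo (B : ℕ) (b : Fin B) (x : Fin n → ℝ × ℝ) : ℝ :=
  orderStat (scores x) (binCut n B b)

/-- The right end point of bin `b`. -/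
noncomputable def binHi (B : ℕ) (b : Fin B) (x : Fin n → ℝ × ℝ) : ℝ :=
  orderStat (scores x) (binCut n B ((b : ℕ) + 1))

/-- The event that a (score, label) pair falls into the interior of bin `b`. -/
def binStrip (B : ℕ) (b : Fin B) (x : Fin n → ℝ × ℝ) : Set (ℝ × ℝ) :=
  strip (binLo B b x) (binHi B b x)

/-- The estimation error of the average label in bin `b`. -/
noncomputable def binErr (Q : Measure (ℝ × ℝ)) (B : ℕ) (x : Fin n → ℝ × ℝ) (b : Fin B) : ℝ :=
  |binMean B (scores x) (labels x) b - stripProb Q (binLo B b x) (binHi B b x)|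

/-- The output value of bin `b`. -/
noncomputable def binValue (B : ℕ) (δ : ℝ) (x : Fin n → ℝ × ℝ) (V : Fin B → I) (b : Fin B) : ℝ :=
  nudge δ (V b) (binMean B (scores x) (labels x) b)

lemma abs_nudge_sub_le {δ : ℝ} (hδ : 0 < δ) (u : I) {s : ℝ} (hs : s ∈ Set.Icc (0 : ℝ) 1) :
    |nudge δ u s - s| ≤ δ := by
  have h1 : (0 : ℝ) < 1 + δ := by linarith
  have h2 : nudge δ u s - s = δ * (u - s) / (1 + δ) := by
    unfold nudge; field_simp; ring
  rw [h2, abs_div, abs_mul, abs_of_pos hδ, abs_of_pos h1, div_le_iff₀ h1]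
  have h3 : |(u : ℝ) - s| ≤ 1 :=
    abs_sub_le_iff.2 ⟨by linarith [u.2.2, hs.1], by linarith [u.2.1, hs.2]⟩
  nlinarith

lemma nudge_mem_Icc {δ : ℝ} (hδ : 0 < δ) (u : I) {s : ℝ} (hs : s ∈ Set.Icc (0 : ℝ) 1) :
    nudge δ u s ∈ Set.Icc (0 : ℝ) 1 := by
  have h1 : (0 : ℝ) < 1 + δ := by linarith
  have hu := u.2
  have h2 := mul_nonneg hδ.le hu.1
  have h3 := mul_le_mul_of_nonneg_left hu.2 hδ.le
  constructor
  · exact div_nonneg (by linarith [hs.1]) h1.le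
  · exact (div_le_one h1).2 (by linarith [hs.2])

lemma measurable_measure_strip_inter (Q : Measure (ℝ × ℝ)) [IsProbabilityMeasure Q]
    {A : Set (ℝ × ℝ)} (hA : MeasurableSet A) :
    Measurable fun p : ℝ × ℝ => Q (strip p.1 p.2 ∩ A) := by
  have hS : MeasurableSet {q : (ℝ × ℝ) × (ℝ × ℝ) | q.2 ∈ strip q.1.1 q.1.2 ∩ A} := by
    refine MeasurableSet.inter (MeasurableSet.inter ?_ ?_) (measurable_snd hA)
    · exact measurableSet_lt (by fun_prop) (by fun_prop : Measurable fun q :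
        (ℝ × ℝ) × (ℝ × ℝ) => q.2.1)
    · exact measurableSet_lt (by fun_prop : Measurable fun q :
        (ℝ × ℝ) × (ℝ × ℝ) => q.2.1) (by fun_prop)
  exact measurable_measure_prodMk_left hS

lemma measurable_measure_strip {α : Type*} [MeasurableSpace α] (Q : Measure (ℝ × ℝ))
    [IsProbabilityMeasure Q] {f g : α → ℝ} (hf : Measurable f) (hg : Measurable g) :
    Measurable fun a => Q (strip (f a) (g a)) := by
  have := (measurable_measure_strip_inter Q MeasurableSet.univ).comp (hf.prodMk hg)
  simpa only [Set.inter_univ, Function.comp_def] using this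

lemma measurable_stripProb {α : Type*} [MeasurableSpace α] (Q : Measure (ℝ × ℝ))
    [IsProbabilityMeasure Q] {f g : α → ℝ} (hf : Measurable f) (hg : Measurable g) :
    Measurable fun a => stripProb Q (f a) (g a) := by
  have h1 := (measurable_measure_strip_inter Q
    (measurable_snd (measurableSet_singleton (1 : ℝ)))).comp (hf.prodMk hg)
  exact h1.ennreal_toReal.div (measurable_measure_strip Q hf hg).ennreal_toReal

lemma measurable_binLo (B : ℕ) (b : Fin B) : Measurable (binLo (n := n) B b) :=
  (measurable_orderStat _).comp measurable_scores

lemma measurable_binHi (B : ℕ) (b : Fin B) : Measurable (binHi (n := n) B b) :=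
  (measurable_orderStat _).comp measurable_scores

lemma measurable_measure_binStrip (Q : Measure (ℝ × ℝ)) [IsProbabilityMeasure Q] (B : ℕ)
    (b : Fin B) : Measurable fun x : Fin n → ℝ × ℝ => Q (binStrip B b x) :=
  measurable_measure_strip Q (measurable_binLo B b) (measurable_binHi B b)

lemma measurable_binMean_labels (B : ℕ) (b : Fin B) :
    Measurable fun x : Fin n → ℝ × ℝ => binMean B (scores x) (labels x) b :=
  (measurable_binMean B b).comp (measurable_scores.prodMk measurable_labels)

lemma measurable_stripProb_bin (Q : Measure (ℝ × ℝ)) [IsProbabilityMeasure Q] (B : ℕ)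
    (b : Fin B) : Measurable fun x : Fin n → ℝ × ℝ => stripProb Q (binLo B b x) (binHi B b x) :=
  measurable_stripProb Q (measurable_binLo B b) (measurable_binHi B b)

lemma measurable_binErr (Q : Measure (ℝ × ℝ)) [IsProbabilityMeasure Q] (B : ℕ) (b : Fin B) :
    Measurable fun x : Fin n → ℝ × ℝ => binErr Q B x b := by
  have h : Measurable fun x : Fin n → ℝ × ℝ =>
      binMean B (scores x) (labels x) b - stripProb Q (binLo B b x) (binHi B b x) :=
    (measurable_binMean_labels B b).sub (measurable_stripProb_bin Q B b)
  exact continuous_abs.measurable.comp h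

lemma measurable_binValue (B : ℕ) (δ : ℝ) (b : Fin B) :
    Measurable fun q : (Fin n → ℝ × ℝ) × (Fin B → I) => binValue B δ q.1 q.2 b := by
  have : Measurable fun q : (Fin n → ℝ × ℝ) × (Fin B → I) =>
      binMean B (scores q.1) (labels q.1) b :=
    (measurable_binMean_labels B b).comp measurable_fst
  unfold binValue nudge
  exact ((this.add (by fun_prop)).div_const _)

/-- In a product of copies of `μ`, two different coordinates almost surely do not satisfy
`f (x i) = g (x j)` if `f` has a continuous law under `μ`. -/
lemma measure_pi_eq_null {ι : Type*} [Fintype ι] {Ω : Type*} [MeasurableSpace Ω] {μ : Measure Ω}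
    [IsProbabilityMeasure μ] {f g : Ω → ℝ} (hf : Measurable f) (hg : Measurable g)
    (h : ∀ v, μ {a | f a = v} = 0) {i j : ι} (hij : i ≠ j) :
    (Measure.pi fun _ : ι => μ) {x | f (x i) = g (x j)} = 0 := by
  have hind : IndepFun (fun x : ι → Ω => x i) (fun x : ι → Ω => x j)
      (Measure.pi fun _ : ι => μ) :=
    (iIndepFun_pi (μ := fun _ : ι => μ) (X := fun _ a => a)
      fun _ => aemeasurable_id).indepFun hij
  have hmap := (indepFun_iff_map_prod_eq_prod_map_map (measurable_pi_apply i).aemeasurable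
    (measurable_pi_apply j).aemeasurable).1 hind
  rw [(measurePreserving_eval (fun _ : ι => μ) i).map_eq,
    (measurePreserving_eval (fun _ : ι => μ) j).map_eq] at hmap
  have hS : MeasurableSet {p : Ω × Ω | f p.1 = g p.2} :=
    measurableSet_eq_fun (hf.comp measurable_fst) (hg.comp measurable_snd)
  have hm : Measurable fun x : ι → Ω => (x i, x j) := by fun_prop
  change (Measure.pi fun _ : ι => μ) ((fun x : ι → Ω => (x i, x j)) ⁻¹' {p | f p.1 = g p.2}) = 0
  rw [← Measure.map_apply hm hS, hmap, Measure.prod_apply_symm hS]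
  simp [h]

variable {Q : Measure (ℝ × ℝ)}

lemma IsScoreLaw.score_mem_Ioo (hQ : IsScoreLaw Q) : ∀ᵐ p ∂Q, p.1 ∈ Set.Ioo (0 : ℝ) 1 := by
  have h : ∀ v : ℝ, ∀ᵐ p ∂Q, p.1 ≠ v := fun v => by
    rw [ae_iff]; simpa using hQ.noAtom v
  filter_upwards [hQ.score_mem, h 0, h 1] with p hp h0 h1
  exact ⟨lt_of_le_of_ne hp.1 h0.symm, lt_of_le_of_ne hp.2 h1⟩

lemma IsScoreLaw.ae_cond_label_mem (hQ : IsScoreLaw Q) (lo hi : ℝ) :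
    ∀ᵐ p ∂Q[|strip lo hi], p.2 ∈ Set.Icc (0 : ℝ) 1 := by
  filter_upwards [cond_absolutelyContinuous.ae_le hQ.label_mem] with p hp
  rcases hp with hp | hp <;> simp [hp]

lemma IsScoreLaw.integral_cond_strip (hQ : IsScoreLaw Q) {lo hi : ℝ} :
    ∫ p, p.2 ∂Q[|strip lo hi] = stripProb Q lo hi := by
  have hm : MeasurableSet {p : ℝ × ℝ | p.2 = 1} := measurable_snd (measurableSet_singleton 1)
  have h1 : (fun p : ℝ × ℝ => p.2) =ᵐ[Q[|strip lo hi]] {p : ℝ × ℝ | p.2 = 1}.indicator 1 := by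
    filter_upwards [cond_absolutelyContinuous.ae_le hQ.label_mem] with p hp
    rcases hp with hp | hp <;> simp [hp]
  rw [integral_congr_ae h1, integral_indicator_one hm, Measure.real,
    cond_apply (measurableSet_strip lo hi), ENNReal.toReal_mul, ENNReal.toReal_inv, stripProb,
    inv_mul_eq_div]
  rfl

variable [IsProbabilityMeasure Q]

lemma IsScoreLaw.ae_noTies (hQ : IsScoreLaw Q) :
    ∀ᵐ x ∂(Measure.pi fun _ : Fin n => Q), NoTies x := by
  have h1 : ∀ i j : Fin n, i ≠ j → ∀ᵐ x ∂(Measure.pi fun _ : Fin n => Q), (x i).1 ≠ (x j).1 := by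
    intro i j hij
    rw [ae_iff]
    simpa using measure_pi_eq_null measurable_fst measurable_fst hQ.noAtom hij
  have h2 : ∀ i : Fin n, ∀ᵐ x ∂(Measure.pi fun _ : Fin n => Q), (x i).1 ∈ Set.Ioo (0 : ℝ) 1 :=
    fun i => (measurePreserving_eval (fun _ : Fin n => Q) i).quasiMeasurePreserving.ae
      hQ.score_mem_Ioo
  have h1' : ∀ᵐ x ∂(Measure.pi fun _ : Fin n => Q), ∀ i j : Fin n, i ≠ j → (x i).1 ≠ (x j).1 :=
    ae_all_iff.2 fun i => ae_all_iff.2 fun j => by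
      by_cases hij : i = j
      · simp [hij]
      · simpa [hij] using h1 i j hij
  filter_upwards [h1', ae_all_iff.2 h2] with x hx1 hx2
  exact ⟨fun i j hij => by_contra fun hne => hx1 i j hne hij, hx2⟩

/-- The bins of histogram binning with `⌊n / k⌋` bins inherit a bound that holds for i.i.d. samples
from the conditional laws `Q(· | strip lo hi)` of size at least `k - 1`. -/
lemma IsScoreLaw.lintegral_bin_le (hQ : IsScoreLaw Q) {k : ℕ} (hk : 2 ≤ k) (hkn : k ≤ n)
    (b : Fin (n / k)) {w : ℝ → ℝ → ℝ≥0∞} (hw : Measurable fun p : ℝ × ℝ => w p.1 p.2)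
    {Ψ : ℝ → ℝ → ℝ → ℝ≥0∞} (hΨ : Measurable fun p : ℝ × ℝ × ℝ => Ψ p.1 p.2.1 p.2.2)
    {C : ℝ≥0∞}
    (hC : ∀ T : Finset (Fin n), k - 1 ≤ T.card → ∀ lo hi, Q (strip lo hi) ≠ 0 →
      ∫⁻ u, Ψ lo hi ((∑ i, (u i).2) / (T.card : ℝ))
        ∂(Measure.pi fun _ : {i // i ∈ T} => Q[|strip lo hi]) ≤ C) :
    ∫⁻ x, w (binLo (n / k) b x) (binHi (n / k) b x) *
        Ψ (binLo (n / k) b x) (binHi (n / k) b x) (binMean (n / k) (scores x) (labels x) b)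
        ∂(Measure.pi fun _ : Fin n => Q) ≤
      C * ∫⁻ x, w (binLo (n / k) b x) (binHi (n / k) b x) ∂(Measure.pi fun _ : Fin n => Q) := by
  have hgap := binCut_add_le (by omega : 0 < k) hkn b
  simp_rw [binMean_eq]
  refine lintegral_between_orderStat_le Q hQ.ae_noTies (by omega)
    (binCut_le (by have := b.2; omega)) hw hΨ fun T hT lo hi => ?_
  have hcard : k - 1 ≤ T.card := by omega
  obtain ⟨i, hi'⟩ := Finset.card_pos.1 (by omega : 0 < T.card)
  have : Nonempty {i // i ∈ T} := ⟨⟨i, hi'⟩⟩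
  exact setLIntegral_pi_le_of_cond Q fun h0 => hC T hcard lo hi h0

lemma IsScoreLaw.ae_measure_binStrip_ne_zero (hQ : IsScoreLaw Q) {k : ℕ} (hk : 2 ≤ k)
    (hkn : k ≤ n) : ∀ᵐ x ∂(Measure.pi fun _ : Fin n => Q), ∀ b, Q (binStrip (n / k) b x) ≠ 0 := by
  refine ae_all_iff.2 fun b => ?_
  have hS : MeasurableSet {p : ℝ × ℝ | Q (strip p.1 p.2) = 0} :=
    measurable_measure_strip Q measurable_fst measurable_snd (measurableSet_singleton 0)
  have := hQ.lintegral_bin_le hk hkn b (w := fun _ _ => 1) measurable_const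
    (Ψ := fun lo hi _ => {p : ℝ × ℝ | Q (strip p.1 p.2) = 0}.indicator 1 (lo, hi))
    ((measurable_one.indicator hS).comp (by fun_prop : Measurable fun p : ℝ × ℝ × ℝ =>
      (p.1, p.2.1))) (C := 0) (fun T _ lo hi h0 => by simp [h0])
  simp only [one_mul, zero_mul, nonpos_iff_eq_zero] at this
  have hmeas : Measurable fun x : Fin n → ℝ × ℝ => {p : ℝ × ℝ | Q (strip p.1 p.2) = 0}.indicator
      (1 : ℝ × ℝ → ℝ≥0∞) (binLo (n / k) b x, binHi (n / k) b x) :=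
    (measurable_one.indicator hS).comp ((measurable_binLo _ b).prodMk (measurable_binHi _ b))
  rw [lintegral_eq_zero_iff hmeas] at this
  filter_upwards [this] with x hx h0
  have h0' : Q (strip (binLo (n / k) b x) (binHi (n / k) b x)) = 0 := h0
  simp [h0'] at hx

lemma IsScoreLaw.lintegral_binErr_gt_le (hQ : IsScoreLaw Q) {k : ℕ} (hk : 2 ≤ k) (hkn : k ≤ n)
    (b : Fin (n / k)) {w : ℝ → ℝ → ℝ≥0∞} (hw : Measurable fun p : ℝ × ℝ => w p.1 p.2)
    {ε : ℝ} (hε : 0 ≤ ε) :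
    ∫⁻ x, w (binLo (n / k) b x) (binHi (n / k) b x) *
        {x | ε < binErr Q (n / k) x b}.indicator 1 x ∂(Measure.pi fun _ : Fin n => Q) ≤
      ENNReal.ofReal (2 * Real.exp (-(2 * ((k : ℝ) - 1) * ε ^ 2))) *
        ∫⁻ x, w (binLo (n / k) b x) (binHi (n / k) b x) ∂(Measure.pi fun _ : Fin n => Q) := by
  have hS : MeasurableSet {p : ℝ × ℝ × ℝ | ε < |p.2.2 - stripProb Q p.1 p.2.1|} := by
    refine measurableSet_lt measurable_const (continuous_abs.measurable.comp ?_)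
    exact (by fun_prop : Measurable fun p : ℝ × ℝ × ℝ => p.2.2).sub (measurable_stripProb Q
      (by fun_prop) (by fun_prop))
  refine hQ.lintegral_bin_le hk hkn b hw
    (Ψ := fun lo hi m => {p : ℝ × ℝ × ℝ | ε < |p.2.2 - stripProb Q p.1 p.2.1|}.indicator 1
      (lo, hi, m)) (measurable_one.indicator hS) fun T hT lo hi h0 => ?_
  have : IsProbabilityMeasure Q[|strip lo hi] := cond_isProbabilityMeasure h0
  obtain ⟨i, hi'⟩ := Finset.card_pos.1 (by omega : 0 < T.card)
  have : Nonempty {i // i ∈ T} := ⟨⟨i, hi'⟩⟩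
  have hT' : (k : ℝ) - 1 ≤ T.card := by
    have : (k : ℝ) ≤ T.card + 1 := by exact_mod_cast (by omega : k ≤ T.card + 1)
    linarith
  have hm := measure_mean_gt_le (ι := {i // i ∈ T}) (ν := Q[|strip lo hi]) measurable_snd
    (hQ.ae_cond_label_mem lo hi) hε
  rw [hQ.integral_cond_strip, Fintype.card_coe] at hm
  refine le_trans (le_of_eq ?_) (hm.trans (ENNReal.ofReal_le_ofReal ?_))
  · rw [← lintegral_indicator_one]
    · rfl
    · refine measurableSet_lt measurable_const (continuous_abs.measurable.comp ?_)
      fun_prop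
  · gcongr

lemma IsScoreLaw.lintegral_binErr_le (hQ : IsScoreLaw Q) {k : ℕ} (hk : 2 ≤ k) (hkn : k ≤ n)
    (b : Fin (n / k)) {w : ℝ → ℝ → ℝ≥0∞} (hw : Measurable fun p : ℝ × ℝ => w p.1 p.2) :
    ∫⁻ x, w (binLo (n / k) b x) (binHi (n / k) b x) *
        ENNReal.ofReal (binErr Q (n / k) x b) ∂(Measure.pi fun _ : Fin n => Q) ≤
      ENNReal.ofReal √(1 / (2 * (k : ℝ))) *
        ∫⁻ x, w (binLo (n / k) b x) (binHi (n / k) b x) ∂(Measure.pi fun _ : Fin n => Q) := by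
  have hΨ : Measurable fun p : ℝ × ℝ × ℝ => ENNReal.ofReal |p.2.2 - stripProb Q p.1 p.2.1| := by
    refine ENNReal.measurable_ofReal.comp (continuous_abs.measurable.comp ?_)
    exact (by fun_prop : Measurable fun p : ℝ × ℝ × ℝ => p.2.2).sub (measurable_stripProb Q
      (by fun_prop) (by fun_prop))
  refine hQ.lintegral_bin_le hk hkn b hw
    (Ψ := fun lo hi m => ENNReal.ofReal |m - stripProb Q lo hi|) hΨ fun T hT lo hi h0 => ?_
  have : IsProbabilityMeasure Q[|strip lo hi] := cond_isProbabilityMeasure h0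
  obtain ⟨i, hi'⟩ := Finset.card_pos.1 (by omega : 0 < T.card)
  have : Nonempty {i // i ∈ T} := ⟨⟨i, hi'⟩⟩
  have hT' : (k : ℝ) ≤ T.card + 1 := by exact_mod_cast (by omega : k ≤ T.card + 1)
  have hk' : (2 : ℝ) ≤ k := by exact_mod_cast hk
  have hm := lintegral_abs_mean_sub_le (ι := {i // i ∈ T}) (ν := Q[|strip lo hi]) measurable_snd
    (hQ.ae_cond_label_mem lo hi)
  rw [hQ.integral_cond_strip, Fintype.card_coe] at hm
  refine hm.trans (ENNReal.ofReal_le_ofReal (Real.sqrt_le_sqrt ?_))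
  exact one_div_le_one_div_of_le (by linarith) (by linarith)

end AbstractBinning

/-! ### The predictor that histogram binning returns -/

section Predictor

open scoped ENNReal

variable {n B : ℕ} {δ : ℝ}

open Classical in
/-- The output of histogram binning as a function of the perturbed score. -/
noncomputable def binPredict (B : ℕ) (δ : ℝ) (x : Fin n → ℝ × ℝ) (V : Fin B → I) (s : ℝ) : ℝ :=
  ∑ b : Fin B, if InBin B (scores x) b s then binValue B δ x V b else 0

lemma NoTies.mem_Icc {x : Fin n → ℝ × ℝ} (hx : NoTies x) (i : Fin n) :
    scores x i ∈ Set.Icc (0 : ℝ) 1 := Set.Ioo_subset_Icc_self (hx.2 i)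

lemma binPredict_of_inBin {x : Fin n → ℝ × ℝ} (hx : ∀ i, scores x i ∈ Set.Icc (0 : ℝ) 1)
    {V : Fin B → I} {b : Fin B} {s : ℝ} (hb : InBin B (scores x) b s) :
    binPredict B δ x V s = binValue B δ x V b := by
  unfold binPredict
  rw [Finset.sum_eq_single b]
  · simp [hb]
  · intro b' _ hne
    rw [if_neg fun h => hne (inBin_unique hx h hb)]
  · simp

lemma measurable_binPredict (x : Fin n → ℝ × ℝ) (V : Fin B → I) :
    Measurable (binPredict B δ x V) := by
  unfold binPredict
  refine Finset.measurable_fun_sum _ fun b _ => Measurable.ite ?_ measurable_const measurable_const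
  have : Measurable fun s : ℝ => (scores x, s) := by fun_prop
  exact this (measurableSet_inBin b)

/-- The sample has no ties and labels in `[0,1]`, all bins have positive probability and different values. -/
structure GoodSample (Q : Measure (ℝ × ℝ)) (B : ℕ) (δ : ℝ) (x : Fin n → ℝ × ℝ)
    (V : Fin B → I) : Prop where
  noTies : NoTies x
  label_mem : ∀ i, labels x i ∈ Set.Icc (0 : ℝ) 1
  pos : ∀ b, Q (binStrip B b x) ≠ 0
  inj : Function.Injective (binValue B δ x V)

variable {Q : Measure (ℝ × ℝ)} [IsProbabilityMeasure Q]

omit [IsProbabilityMeasure Q] in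
lemma ae_injective_binValue (hδ : 0 < δ) :
    ∀ᵐ q ∂(Measure.pi fun _ : Fin n => Q).prod (volume : Measure (Fin B → I)),
      Function.Injective (binValue B δ q.1 q.2) := by
  have key : ∀ b b' : Fin B, b ≠ b' →
      ∀ᵐ q ∂(Measure.pi fun _ : Fin n => Q).prod (volume : Measure (Fin B → I)),
      binValue B δ q.1 q.2 b ≠ binValue B δ q.1 q.2 b' := by
    intro b b' hb
    rw [ae_iff]
    simp only [ne_eq, not_not]
    have hS : MeasurableSet {q : (Fin n → ℝ × ℝ) × (Fin B → I) |
        binValue B δ q.1 q.2 b = binValue B δ q.1 q.2 b'} :=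
      measurableSet_eq_fun (measurable_binValue B δ b) (measurable_binValue B δ b')
    rw [Measure.measure_prod_null hS]
    refine Filter.Eventually.of_forall fun x => ?_
    have h := measure_pi_eq_null (μ := (volume : Measure I)) (f := fun u => (u : ℝ))
      (g := fun u => (u : ℝ) + (binMean B (scores x) (labels x) b' -
        binMean B (scores x) (labels x) b) / δ) (by fun_prop) (by fun_prop)
      (fun v => Set.Subsingleton.measure_zero (fun u hu u' hu' =>
        Subtype.ext ((show (u : ℝ) = v from hu).trans (show (u' : ℝ) = v from hu').symm)) _) hb
    refine measure_mono_null (fun V hV => ?_) h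
    have hV' : nudge δ (V b) (binMean B (scores x) (labels x) b) =
      nudge δ (V b') (binMean B (scores x) (labels x) b') := hV
    have h1 : (1 + δ) ≠ 0 := by positivity
    unfold nudge at hV'
    rw [div_left_inj' h1] at hV'
    change ((V b : I) : ℝ) = (V b' : ℝ) + _
    field_simp
    linarith
  have : ∀ᵐ q ∂(Measure.pi fun _ : Fin n => Q).prod (volume : Measure (Fin B → I)),
      ∀ b b' : Fin B, b ≠ b' → binValue B δ q.1 q.2 b ≠ binValue B δ q.1 q.2 b' :=
    ae_all_iff.2 fun b => ae_all_iff.2 fun b' => by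
      by_cases h : b = b'
      · simp [h]
      · simpa [h] using key b b' h
  filter_upwards [this] with q hq b b' hbb
  exact by_contra fun hne => hq b b' hne hbb

lemma IsScoreLaw.ae_goodSample (hQ : IsScoreLaw Q) {k : ℕ} (hk : 2 ≤ k) (hkn : k ≤ n)
    (hδ : 0 < δ) :
    ∀ᵐ q ∂(Measure.pi fun _ : Fin n => Q).prod (volume : Measure (Fin (n / k) → I)),
      GoodSample Q (n / k) δ q.1 q.2 := by
  have hlab : ∀ᵐ x ∂(Measure.pi fun _ : Fin n => Q), ∀ i, labels x i ∈ Set.Icc (0 : ℝ) 1 :=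
    ae_all_iff.2 fun i => by
      filter_upwards [(measurePreserving_eval (fun _ : Fin n => Q) i).quasiMeasurePreserving.ae
        hQ.label_mem] with x hx
      unfold labels
      rcases hx with hx | hx <;> simp only [Function.eval] at hx <;> simp [hx]
  filter_upwards [Measure.quasiMeasurePreserving_fst.ae hQ.ae_noTies,
    Measure.quasiMeasurePreserving_fst.ae hlab,
    Measure.quasiMeasurePreserving_fst.ae (hQ.ae_measure_binStrip_ne_zero hk hkn),
    ae_injective_binValue hδ] with q h1 h2 h3 h4
  exact ⟨h1, h2, h3, h4⟩

omit [IsProbabilityMeasure Q] in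
lemma IsScoreLaw.ae_inBin_iff (hQ : IsScoreLaw Q) (x : Fin n → ℝ × ℝ) :
    ∀ᵐ p ∂Q, ∀ b : Fin B, InBin B (scores x) b p.1 ↔ p ∈ binStrip B b x := by
  have h : ∀ᵐ p ∂Q, ∀ b : Fin B, p.1 ≠ binLo B b x := ae_all_iff.2 fun b => by
    rw [ae_iff]; simpa using hQ.noAtom _
  filter_upwards [h, hQ.score_mem_Ioo] with p hp hp1 b
  constructor
  · rintro ⟨h1, h2⟩
    refine ⟨lt_of_le_of_ne h1 (hp b).symm, ?_⟩
    rcases h2 with h2 | h2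
    · exact h2
    · have hB : 0 < B := by omega
      have : binHi B b x = 1 := by
        unfold binHi
        rw [h2, binCut_last hB, orderStat_last]
      rw [this]
      exact hp1.2
  · rintro ⟨h1, h2⟩
    exact ⟨h1.le, Or.inl h2⟩

omit [IsProbabilityMeasure Q] in
lemma IsScoreLaw.measure_inBin (hQ : IsScoreLaw Q) (x : Fin n → ℝ × ℝ) (b : Fin B) :
    Q {p | InBin B (scores x) b p.1} = Q (binStrip B b x) := by
  refine measure_congr ?_
  filter_upwards [hQ.ae_inBin_iff x] with p hp
  exact propext (hp b)

lemma sum_measure_binStrip_le_one {x : Fin n → ℝ × ℝ} (hx : NoTies x) :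
    ∑ b : Fin B, Q (binStrip B b x) ≤ 1 := by
  rw [← measure_univ (μ := Q)]
  refine sum_measure_le_measure_univ (fun b _ => (measurableSet_strip _ _).nullMeasurableSet) ?_
  intro b _ b' _ hne
  refine (Set.disjoint_left.2 fun p hp hp' => hne ?_).aedisjoint
  exact inBin_unique hx.mem_Icc (s := p.1) ⟨hp.1.le, Or.inl hp.2⟩ ⟨hp'.1.le, Or.inl hp'.2⟩

lemma sum_measureReal_binStrip_le_one {x : Fin n → ℝ × ℝ} (hx : NoTies x) :
    ∑ b : Fin B, Q.real (binStrip B b x) ≤ 1 := by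
  have h := ENNReal.toReal_mono ENNReal.one_ne_top (sum_measure_binStrip_le_one (Q := Q) (B := B) hx)
  rwa [ENNReal.toReal_sum fun _ _ => measure_ne_top _ _, ENNReal.toReal_one] at h

omit [IsProbabilityMeasure Q] in
lemma GoodSample.binPredict_eq_iff (hQ : IsScoreLaw Q) (hB : 0 < B) {x : Fin n → ℝ × ℝ}
    {V : Fin B → I} (h : GoodSample Q B δ x V) (b : Fin B) :
    ∀ᵐ p ∂Q, binPredict B δ x V p.1 = binValue B δ x V b ↔ p ∈ binStrip B b x := by
  filter_upwards [hQ.ae_inBin_iff x, hQ.score_mem] with p hp hp1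
  obtain ⟨b', hb'⟩ := exists_inBin hB (scores x) hp1.1
  rw [← hp b, binPredict_of_inBin h.noTies.mem_Icc hb', h.inj.eq_iff]
  exact ⟨fun hbb => hbb ▸ hb', fun hb => inBin_unique h.noTies.mem_Icc hb' hb⟩

variable {Ω : Type*} [MeasurableSpace Ω] {m : Measure Ω} [IsProbabilityMeasure m]
  {L : ℕ} [NeZero L] {S : Ω → ℝ} {Y : Ω → Fin L} {l : Fin L}

omit [IsProbabilityMeasure Q] in
/-- The true class probability, given the value of the predictor. -/
lemma GoodSample.condDistrib_binPredict (hQ : IsScoreLaw Q) (hB : 0 < B) {x : Fin n → ℝ × ℝ}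
    {V : Fin B → I} (h : GoodSample Q B δ x V) (hS : Measurable S) (hY : Measurable Y)
    (hmap : m.map (fun ω => (S ω, if Y ω = l then (1 : ℝ) else 0)) = Q) (b : Fin B) :
    (condDistrib Y (fun ω => binPredict B δ x V (S ω)) m (binValue B δ x V b)).real {l} =
      stripProb Q (binLo B b x) (binHi B b x) := by
  have hH : Measurable fun ω => binPredict B δ x V (S ω) := (measurable_binPredict x V).comp hS
  have hφ : Measurable fun ω => (S ω, if Y ω = l then (1 : ℝ) else 0) :=
    hS.prodMk (Measurable.ite (hY (measurableSet_singleton l)) measurable_const measurable_const)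
  have hP : MeasurableSet {p : ℝ × ℝ | binPredict B δ x V p.1 = binValue B δ x V b} :=
    (measurable_binPredict x V).comp measurable_fst (measurableSet_singleton _)
  have h1m : MeasurableSet {p : ℝ × ℝ | p.2 = 1} := measurable_snd (measurableSet_singleton _)
  have h1 : m.map (fun ω => binPredict B δ x V (S ω)) {binValue B δ x V b} =
      Q (binStrip B b x) := by
    rw [Measure.map_apply hH (measurableSet_singleton _)]
    calc _ = Q {p : ℝ × ℝ | binPredict B δ x V p.1 = binValue B δ x V b} := by
          rw [← hmap, Measure.map_apply hφ hP]; rfl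
      _ = Q (binStrip B b x) := by
          refine measure_congr ?_
          filter_upwards [h.binPredict_eq_iff hQ hB b] with p hp using propext hp
  have h2 : m.map (fun ω => (binPredict B δ x V (S ω), Y ω)) ({binValue B δ x V b} ×ˢ {l}) =
      Q (binStrip B b x ∩ {p | p.2 = 1}) := by
    rw [Measure.map_apply (hH.prodMk hY)
      ((measurableSet_singleton _).prod (measurableSet_singleton _))]
    calc _ = Q ({p : ℝ × ℝ | binPredict B δ x V p.1 = binValue B δ x V b} ∩ {p | p.2 = 1}) := by
          rw [← hmap, Measure.map_apply hφ (hP.inter h1m)]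
          congr 1
          ext ω
          by_cases hω : Y ω = l <;> simp [hω]
      _ = Q (binStrip B b x ∩ {p | p.2 = 1}) := by
          refine measure_congr ?_
          filter_upwards [h.binPredict_eq_iff hQ hB b] with p hp
          exact propext (and_congr_left' hp)
  have h0 : m.map (fun ω => binPredict B δ x V (S ω)) {binValue B δ x V b} ≠ 0 := by
    rw [h1]; exact h.pos b
  rw [Measure.real, condDistrib_apply_of_ne_zero hY _ h0, h1, h2, ENNReal.toReal_mul,
    ENNReal.toReal_inv, inv_mul_eq_div]
  rfl

/-- The expected calibration error of the output of histogram binning. -/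
noncomputable def binECE (Q : Measure (ℝ × ℝ)) (B : ℕ) (δ : ℝ) (x : Fin n → ℝ × ℝ)
    (V : Fin B → I) : ℝ :=
  ∑ b : Fin B, Q.real (binStrip B b x) *
    |stripProb Q (binLo B b x) (binHi B b x) - binValue B δ x V b|

lemma GoodSample.integral_abs_condDistrib_sub (hQ : IsScoreLaw Q) (hB : 0 < B)
    {x : Fin n → ℝ × ℝ} {V : Fin B → I} (h : GoodSample Q B δ x V) (hS : Measurable S)
    (hY : Measurable Y)
    (hmap : m.map (fun ω => (S ω, if Y ω = l then (1 : ℝ) else 0)) = Q) :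
    ∫ ω, |(condDistrib Y (fun ω => binPredict B δ x V (S ω)) m
        (binPredict B δ x V (S ω))).real {l} - binPredict B δ x V (S ω)| ∂m =
      binECE Q B δ x V := by
  have hφ : Measurable fun ω => (S ω, if Y ω = l then (1 : ℝ) else 0) :=
    hS.prodMk (Measurable.ite (hY (measurableSet_singleton l)) measurable_const measurable_const)
  let G : ℝ × ℝ → ℝ := fun p => ∑ b : Fin B, (binStrip B b x).indicator
    (fun _ => |stripProb Q (binLo B b x) (binHi B b x) - binValue B δ x V b|) p
  have hG : Measurable G := Finset.measurable_fun_sum _ fun b _ =>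
    measurable_const.indicator (measurableSet_strip _ _)
  have hae : ∀ᵐ p ∂Q, ∃ b, InBin B (scores x) b p.1 ∧
      G p = |stripProb Q (binLo B b x) (binHi B b x) - binValue B δ x V b| := by
    filter_upwards [hQ.ae_inBin_iff x, hQ.score_mem] with p hp hp1
    obtain ⟨b, hb⟩ := exists_inBin hB (scores x) hp1.1
    refine ⟨b, hb, ?_⟩
    simp only [G]
    rw [Finset.sum_eq_single b]
    · rw [Set.indicator_of_mem ((hp b).1 hb)]
    · intro b' _ hne
      refine Set.indicator_of_notMem (fun hb' => hne ?_) _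
      exact inBin_unique h.noTies.mem_Icc ((hp b').2 hb') hb
    · simp
  have hpull : ∀ {r : ℝ × ℝ → Prop}, (∀ᵐ p ∂Q, r p) →
      ∀ᵐ ω ∂m, r (S ω, if Y ω = l then (1 : ℝ) else 0) := fun hr =>
    ae_of_ae_map hφ.aemeasurable (by rwa [hmap])
  have hae' := hpull hae
  calc _ = ∫ ω, G (S ω, if Y ω = l then (1 : ℝ) else 0) ∂m := by
        refine integral_congr_ae ?_
        filter_upwards [hae'] with ω ⟨b, hb, hGb⟩
        rw [hGb, binPredict_of_inBin h.noTies.mem_Icc hb,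
          h.condDistrib_binPredict hQ hB hS hY hmap b]
    _ = ∫ p, G p ∂Q := by
        rw [← hmap]
        exact (integral_map hφ.aemeasurable hG.aestronglyMeasurable).symm
    _ = binECE Q B δ x V := by
        simp only [G]
        rw [integral_finsetSum]
        · refine Finset.sum_congr rfl fun b _ => ?_
          rw [integral_indicator_const _ (show MeasurableSet (binStrip B b x) from
            measurableSet_strip _ _), smul_eq_mul]
        · exact fun b _ => (integrable_const _).indicator (measurableSet_strip _ _)

end Predictor

/-! ### Calibration of binary histogram binning -/

section BinaryCalibration

open scoped ENNReal

lemma binMean_mem_Icc {n B : ℕ} (t : Fin n → ℝ) {y : Fin n → ℝ}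
    (hy : ∀ i, y i ∈ Set.Icc (0 : ℝ) 1) (b : Fin B) : binMean B t y b ∈ Set.Icc (0 : ℝ) 1 := by
  unfold binMean
  refine ⟨div_nonneg (Finset.sum_nonneg fun i _ => (hy _).1) (Nat.cast_nonneg _),
    div_le_one_of_le₀ ?_ (Nat.cast_nonneg _)⟩
  refine (Finset.sum_le_card_nsmul _ _ 1 fun i _ => (hy _).2).trans (by simp)

variable {n B : ℕ} {δ : ℝ} {Q : Measure (ℝ × ℝ)}

lemma abs_stripProb_sub_binValue_le (hδ : 0 < δ) {x : Fin n → ℝ × ℝ}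
    (hx : ∀ i, labels x i ∈ Set.Icc (0 : ℝ) 1) (V : Fin B → I) (b : Fin B) :
    |stripProb Q (binLo B b x) (binHi B b x) - binValue B δ x V b| ≤ binErr Q B x b + δ := by
  have h1 := abs_nudge_sub_le hδ (V b) (binMean_mem_Icc (scores x) hx b)
  rw [abs_sub_comm]
  exact (abs_sub_le _ (binMean B (scores x) (labels x) b) _).trans
    (by unfold binErr binValue; linarith)

lemma binErr_nonneg (x : Fin n → ℝ × ℝ) (b : Fin B) : 0 ≤ binErr Q B x b := abs_nonneg _

lemma binECE_nonneg (q : (Fin n → ℝ × ℝ) × (Fin B → I)) : 0 ≤ binECE Q B δ q.1 q.2 :=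
  Finset.sum_nonneg fun _ _ => mul_nonneg measureReal_nonneg (abs_nonneg _)

variable [IsProbabilityMeasure Q]

lemma GoodSample.binECE_le (hδ : 0 < δ) {x : Fin n → ℝ × ℝ} {V : Fin B → I}
    (h : GoodSample Q B δ x V) {ε : ℝ} (hε : 0 ≤ ε) (hx : ∀ b, binErr Q B x b ≤ ε) :
    binECE Q B δ x V ≤ ε + δ := by
  calc binECE Q B δ x V ≤ ∑ b : Fin B, Q.real (binStrip B b x) * (ε + δ) := by
        refine Finset.sum_le_sum fun b _ => mul_le_mul_of_nonneg_left ?_ measureReal_nonneg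
        exact (abs_stripProb_sub_binValue_le hδ h.label_mem V b).trans (by linarith [hx b])
    _ = (∑ b : Fin B, Q.real (binStrip B b x)) * (ε + δ) := by rw [Finset.sum_mul]
    _ ≤ 1 * (ε + δ) := by
        gcongr
        exact sum_measureReal_binStrip_le_one h.noTies
    _ = ε + δ := one_mul _

lemma measurable_binECE :
    Measurable fun q : (Fin n → ℝ × ℝ) × (Fin B → I) => binECE Q B δ q.1 q.2 := by
  unfold binECE
  refine Finset.measurable_fun_sum _ fun b _ => ?_
  have h1 : Measurable fun q : (Fin n → ℝ × ℝ) × (Fin B → I) => Q.real (binStrip B b q.1) :=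
    ((measurable_measure_binStrip Q B b).comp measurable_fst).ennreal_toReal
  have h2 : Measurable fun q : (Fin n → ℝ × ℝ) × (Fin B → I) =>
      stripProb Q (binLo B b q.1) (binHi B b q.1) - binValue B δ q.1 q.2 b :=
    ((measurable_stripProb_bin Q B b).comp measurable_fst).sub (measurable_binValue B δ b)
  exact h1.mul (continuous_abs.measurable.comp h2)

lemma measurableSet_lt_binErr (ε : ℝ) (b : Fin B) :
    MeasurableSet {x : Fin n → ℝ × ℝ | ε < binErr Q B x b} :=
  measurableSet_lt measurable_const (measurable_binErr Q B b)

variable {k : ℕ}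

lemma IsScoreLaw.measure_exists_lt_binErr_le (hQ : IsScoreLaw Q) (hk : 2 ≤ k) (hkn : k ≤ n)
    {ε : ℝ} (hε : 0 ≤ ε) :
    (Measure.pi fun _ : Fin n => Q) {x | ∃ b, ε < binErr Q (n / k) x b} ≤
      ENNReal.ofReal ((n / k : ℕ) * (2 * Real.exp (-(2 * ((k : ℝ) - 1) * ε ^ 2)))) := by
  have hb : ∀ b, (Measure.pi fun _ : Fin n => Q) {x | ε < binErr Q (n / k) x b} ≤
      ENNReal.ofReal (2 * Real.exp (-(2 * ((k : ℝ) - 1) * ε ^ 2))) := by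
    intro b
    have := hQ.lintegral_binErr_gt_le hk hkn b (w := fun _ _ => 1) measurable_const hε
    simpa [lintegral_indicator_one (measurableSet_lt_binErr ε b)] using this
  have hset : {x : Fin n → ℝ × ℝ | ∃ b, ε < binErr Q (n / k) x b} =
      ⋃ b, {x | ε < binErr Q (n / k) x b} := by
    ext x; simp
  rw [hset]
  refine (measure_iUnion_fintype_le _ _).trans ((Finset.sum_le_sum fun b _ => hb b).trans ?_)
  rw [Finset.sum_const, Finset.card_univ, Fintype.card_fin, nsmul_eq_mul,
    ENNReal.ofReal_mul (Nat.cast_nonneg _), ENNReal.ofReal_natCast]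

lemma IsScoreLaw.sum_lintegral_measure_binStrip_le_one (hQ : IsScoreLaw Q) :
    ∑ b : Fin B, ∫⁻ x, Q (binStrip B b x) ∂(Measure.pi fun _ : Fin n => Q) ≤ 1 := by
  rw [← lintegral_finsetSum _ fun b _ => measurable_measure_binStrip Q B b]
  calc _ ≤ ∫⁻ _, 1 ∂(Measure.pi fun _ : Fin n => Q) := by
        refine lintegral_mono_ae ?_
        filter_upwards [hQ.ae_noTies] with x hx using sum_measure_binStrip_le_one hx
    _ = 1 := by simp

lemma IsScoreLaw.measure_exists_inBin_le (hQ : IsScoreLaw Q) (hk : 2 ≤ k) (hkn : k ≤ n)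
    {ε : ℝ} (hε : 0 ≤ ε) :
    ((Measure.pi fun _ : Fin n => Q).prod Q) {q | ∃ b : Fin (n / k),
        InBin (n / k) (scores q.1) b q.2.1 ∧ ε < binErr Q (n / k) q.1 b} ≤
      ENNReal.ofReal (2 * Real.exp (-(2 * ((k : ℝ) - 1) * ε ^ 2))) := by
  set C := ENNReal.ofReal (2 * Real.exp (-(2 * ((k : ℝ) - 1) * ε ^ 2)))
  have hset : {q : (Fin n → ℝ × ℝ) × (ℝ × ℝ) | ∃ b : Fin (n / k),
        InBin (n / k) (scores q.1) b q.2.1 ∧ ε < binErr Q (n / k) q.1 b} =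
      ⋃ b : Fin (n / k), {q | InBin (n / k) (scores q.1) b q.2.1 ∧
        ε < binErr Q (n / k) q.1 b} := by
    ext q; simp
  have hb : ∀ b : Fin (n / k), ((Measure.pi fun _ : Fin n => Q).prod Q)
      {q | InBin (n / k) (scores q.1) b q.2.1 ∧ ε < binErr Q (n / k) q.1 b} ≤
        C * ∫⁻ x, Q (binStrip (n / k) b x) ∂(Measure.pi fun _ : Fin n => Q) := by
    intro b
    have hm : MeasurableSet {q : (Fin n → ℝ × ℝ) × (ℝ × ℝ) |
        InBin (n / k) (scores q.1) b q.2.1 ∧ ε < binErr Q (n / k) q.1 b} := by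
      have h1 : Measurable fun q : (Fin n → ℝ × ℝ) × (ℝ × ℝ) => (scores q.1, q.2.1) := by fun_prop
      exact (h1 (measurableSet_inBin b)).inter (measurable_fst (measurableSet_lt_binErr ε b))
    rw [Measure.prod_apply hm]
    refine le_trans (le_of_eq (lintegral_congr fun x => ?_))
      (hQ.lintegral_binErr_gt_le hk hkn b (w := fun lo hi => Q (strip lo hi))
        (measurable_measure_strip Q measurable_fst measurable_snd) hε)
    by_cases hx : ε < binErr Q (n / k) x b
    · have : Prod.mk x ⁻¹' {q : (Fin n → ℝ × ℝ) × (ℝ × ℝ) |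
          InBin (n / k) (scores q.1) b q.2.1 ∧ ε < binErr Q (n / k) q.1 b} =
          {p | InBin (n / k) (scores x) b p.1} := by ext p; simp [hx]
      rw [this, hQ.measure_inBin]
      simp [hx, binStrip]
    · have : Prod.mk x ⁻¹' {q : (Fin n → ℝ × ℝ) × (ℝ × ℝ) |
          InBin (n / k) (scores q.1) b q.2.1 ∧ ε < binErr Q (n / k) q.1 b} = ∅ := by
        ext p; simp [hx]
      rw [this]
      simp [hx]
  rw [hset]
  refine (measure_iUnion_fintype_le _ _).trans ((Finset.sum_le_sum fun b _ => hb b).trans ?_)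
  rw [← Finset.mul_sum]
  exact (mul_le_mul_right hQ.sum_lintegral_measure_binStrip_le_one C).trans_eq (mul_one C)

lemma IsScoreLaw.lintegral_binECE_le (hQ : IsScoreLaw Q) (hk : 2 ≤ k) (hkn : k ≤ n)
    (hδ : 0 < δ) :
    ∫⁻ q, ENNReal.ofReal (binECE Q (n / k) δ q.1 q.2)
        ∂(Measure.pi fun _ : Fin n => Q).prod (volume : Measure (Fin (n / k) → I)) ≤
      ENNReal.ofReal (√(1 / (2 * (k : ℝ))) + δ) := by
  set c := √(1 / (2 * (k : ℝ)))
  have hterm : ∀ b : Fin (n / k), Measurable fun x : Fin n → ℝ × ℝ =>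
      Q (binStrip (n / k) b x) * (ENNReal.ofReal (binErr Q (n / k) x b) + ENNReal.ofReal δ) :=
    fun b => (measurable_measure_binStrip Q _ b).mul
      ((ENNReal.measurable_ofReal.comp (measurable_binErr Q _ b)).add_const _)
  calc _ ≤ ∫⁻ q, ∑ b : Fin (n / k), Q (binStrip (n / k) b q.1) *
        (ENNReal.ofReal (binErr Q (n / k) q.1 b) + ENNReal.ofReal δ)
        ∂(Measure.pi fun _ : Fin n => Q).prod (volume : Measure (Fin (n / k) → I)) := by
        refine lintegral_mono_ae ?_
        filter_upwards [hQ.ae_goodSample hk hkn hδ] with q hq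
        unfold binECE
        rw [ENNReal.ofReal_sum_of_nonneg fun b _ => mul_nonneg measureReal_nonneg (abs_nonneg _)]
        refine Finset.sum_le_sum fun b _ => ?_
        rw [ENNReal.ofReal_mul measureReal_nonneg, ofReal_measureReal (measure_ne_top _ _),
          ← ENNReal.ofReal_add (binErr_nonneg _ b) hδ.le]
        gcongr
        exact abs_stripProb_sub_binValue_le hδ hq.label_mem q.2 b
    _ = ∫⁻ x, ∑ b : Fin (n / k), Q (binStrip (n / k) b x) *
        (ENNReal.ofReal (binErr Q (n / k) x b) + ENNReal.ofReal δ)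
        ∂(Measure.pi fun _ : Fin n => Q) := by
        exact (measurePreserving_fst (μ := Measure.pi fun _ : Fin n => Q)
          (ν := (volume : Measure (Fin (n / k) → I)))).lintegral_comp
          (Finset.measurable_fun_sum _ fun b _ => hterm b)
    _ = ∑ b : Fin (n / k), ∫⁻ x, Q (binStrip (n / k) b x) *
        (ENNReal.ofReal (binErr Q (n / k) x b) + ENNReal.ofReal δ)
        ∂(Measure.pi fun _ : Fin n => Q) := lintegral_finsetSum _ fun b _ => hterm b
    _ ≤ ∑ b : Fin (n / k), (ENNReal.ofReal c + ENNReal.ofReal δ) *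
        ∫⁻ x, Q (binStrip (n / k) b x) ∂(Measure.pi fun _ : Fin n => Q) := by
        refine Finset.sum_le_sum fun b _ => ?_
        simp_rw [mul_add]
        rw [lintegral_add_right _ ((measurable_measure_binStrip Q _ b).mul_const _),
          lintegral_mul_const _ (measurable_measure_binStrip Q _ b), add_mul,
          mul_comm _ (ENNReal.ofReal δ)]
        gcongr
        exact hQ.lintegral_binErr_le hk hkn b (w := fun lo hi => Q (strip lo hi))
          (measurable_measure_strip Q measurable_fst measurable_snd)
    _ ≤ (ENNReal.ofReal c + ENNReal.ofReal δ) * 1 := by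
        rw [← Finset.mul_sum]
        exact mul_le_mul_right hQ.sum_lintegral_measure_binStrip_le_one _
    _ = ENNReal.ofReal (c + δ) := by
        rw [mul_one, ENNReal.ofReal_add (Real.sqrt_nonneg _) hδ.le]

lemma IsScoreLaw.integrable_binECE (hQ : IsScoreLaw Q) (hk : 2 ≤ k) (hkn : k ≤ n)
    (hδ : 0 < δ) :
    Integrable (fun q : (Fin n → ℝ × ℝ) × (Fin (n / k) → I) => binECE Q (n / k) δ q.1 q.2)
      ((Measure.pi fun _ : Fin n => Q).prod (volume : Measure (Fin (n / k) → I))) := by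
  refine ⟨measurable_binECE.aestronglyMeasurable, ?_⟩
  rw [hasFiniteIntegral_iff_ofReal (Filter.Eventually.of_forall binECE_nonneg)]
  exact (hQ.lintegral_binECE_le hk hkn hδ).trans_lt ENNReal.ofReal_lt_top

lemma IsScoreLaw.integral_binECE_le (hQ : IsScoreLaw Q) (hk : 2 ≤ k) (hkn : k ≤ n)
    (hδ : 0 < δ) :
    ∫ q, binECE Q (n / k) δ q.1 q.2
        ∂(Measure.pi fun _ : Fin n => Q).prod (volume : Measure (Fin (n / k) → I)) ≤
      √(1 / (2 * (k : ℝ))) + δ := by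
  rw [integral_eq_lintegral_of_nonneg_ae
    (Filter.Eventually.of_forall binECE_nonneg)
    measurable_binECE.aestronglyMeasurable]
  exact ENNReal.toReal_le_of_le_ofReal (by positivity) (hQ.lintegral_binECE_le hk hkn hδ)

end BinaryCalibration

/-! ### From the class-wise problem to the binary one -/

section ClasswiseCalibration

open scoped ENNReal

lemma probAtLeast_of_ae {Ω : Type*} [MeasurableSpace Ω] {μ : Measure Ω} [IsProbabilityMeasure μ]
    {S N : Set Ω} (hN : MeasurableSet N) {a : ℝ} (ha : 0 ≤ a) (hNa : μ N ≤ ENNReal.ofReal a)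
    (hS : ∀ᵐ ω ∂μ, ω ∉ N → ω ∈ S) : ProbAtLeast μ S (1 - a) := by
  obtain ⟨M, hM, hMm, hM0⟩ := exists_measurable_superset_of_null (ae_iff.1 hS)
  refine ⟨(N ∪ M)ᶜ, fun ω hω => ?_, (hN.union hMm).compl, ?_⟩
  · by_contra hωS
    exact hω (by
      by_cases hωN : ω ∈ N
      · exact Or.inl hωN
      · exact Or.inr (hM fun h => hωS (h hωN)))
  · rw [probReal_compl_eq_one_sub (hN.union hMm)]
    have h1 : μ (N ∪ M) ≤ ENNReal.ofReal a :=
      (measure_union_le _ _).trans (by rw [hM0, add_zero]; exact hNa)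
    have h2 : μ.real (N ∪ M) ≤ a := ENNReal.toReal_le_of_le_ofReal ha h1
    linarith

variable {X : Type*} [MeasurableSpace X] {L n : ℕ}

/-- The perturbed score for class `l` and the indicator of class `l`. -/
noncomputable def scorePair (g : X → stdSimplex ℝ (Fin L)) (l : Fin L) (δ : ℝ)
    (q : (X × Fin L) × I) : ℝ × ℝ :=
  (nudge δ q.2 ((g q.1.1 : Fin L → ℝ) l), if q.1.2 = l then 1 else 0)

/-- The law of the perturbed score for class `l` and the indicator of class `l`. -/
noncomputable def scoreLaw (P : Measure (X × Fin L)) (g : X → stdSimplex ℝ (Fin L)) (l : Fin L)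
    (δ : ℝ) : Measure (ℝ × ℝ) :=
  (P.prod (volume : Measure I)).map (scorePair g l δ)

/-- The sample of perturbed scores and labels for class `l`. -/
noncomputable def classSample (g : X → stdSimplex ℝ (Fin L)) (l : Fin L) (δ : ℝ)
    (D : Fin n → X × Fin L) (U : Fin n → I) : Fin n → ℝ × ℝ :=
  fun i => scorePair g l δ (D i, U i)

omit [MeasurableSpace X] in
lemma classwiseHB_eq (k : Fin L → ℕ) (δ : ℝ) (g : X → stdSimplex ℝ (Fin L))
    (D : Fin n → X × Fin L) (ω : Seed L n k) (x : X) (z : Fin L → I) (l : Fin L) :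
    classwiseHB X L n k δ g D ω x z l =
      binPredict (n / k l) δ (classSample g l δ D (ω.1 l)) (ω.2 l)
        (nudge δ (z l) ((g x : Fin L → ℝ) l)) := rfl

variable {g : X → stdSimplex ℝ (Fin L)} {δ : ℝ}

lemma measurable_nudge_apply (hg : Measurable g) (l : Fin L) :
    Measurable fun q : X × I => nudge δ q.2 ((g q.1 : Fin L → ℝ) l) := by
  have h : Measurable fun q : X × I => (g q.1 : Fin L → ℝ) l :=
    (measurable_pi_apply l).comp (measurable_subtype_coe.comp (hg.comp measurable_fst))
  unfold nudge
  exact (h.add (by fun_prop)).div_const _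

lemma measurable_scorePair (hg : Measurable g) (l : Fin L) : Measurable (scorePair g l δ) := by
  refine Measurable.prodMk ?_ (Measurable.ite ?_ measurable_const measurable_const)
  · exact (measurable_nudge_apply hg l).comp
      (by fun_prop : Measurable fun q : (X × Fin L) × I => (q.1.1, q.2))
  · exact (by fun_prop : Measurable fun q : (X × Fin L) × I => q.1.2) (measurableSet_singleton l)

lemma nudge_simplex_mem_Icc (hδ : 0 < δ) (s : stdSimplex ℝ (Fin L)) (l : Fin L) (u : I) :
    nudge δ u ((s : Fin L → ℝ) l) ∈ Set.Icc (0 : ℝ) 1 := by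
  refine nudge_mem_Icc hδ u ⟨s.2.1 l, ?_⟩
  rw [← s.2.2]
  exact Finset.single_le_sum (fun i _ => s.2.1 i) (Finset.mem_univ l)

variable {P : Measure (X × Fin L)} [IsProbabilityMeasure P]

lemma isProbabilityMeasure_scoreLaw (hg : Measurable g) (l : Fin L) :
    IsProbabilityMeasure (scoreLaw P g l δ) :=
  Measure.isProbabilityMeasure_map (measurable_scorePair hg l).aemeasurable

omit [IsProbabilityMeasure P] in
lemma isScoreLaw_scoreLaw (hg : Measurable g) (hδ : 0 < δ) (l : Fin L) :
    IsScoreLaw (scoreLaw P g l δ) := by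
  have hm := measurable_scorePair (δ := δ) hg l
  refine ⟨?_, ?_, fun v => ?_⟩
  · refine (ae_map_iff hm.aemeasurable (measurable_fst measurableSet_Icc)).2 ?_
    exact Filter.Eventually.of_forall fun q => nudge_simplex_mem_Icc hδ _ l _
  · refine (ae_map_iff hm.aemeasurable ((measurable_snd (measurableSet_singleton 0)).union
      (measurable_snd (measurableSet_singleton 1)))).2 (Filter.Eventually.of_forall fun q => ?_)
    change (scorePair g l δ q).2 = 0 ∨ (scorePair g l δ q).2 = 1
    by_cases h : q.1.2 = l <;> simp [scorePair, h]
  · have hv : MeasurableSet {p : ℝ × ℝ | p.1 = v} := measurable_fst (measurableSet_singleton v)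
    rw [scoreLaw, Measure.map_apply hm hv, Measure.measure_prod_null (hm hv)]
    refine Filter.Eventually.of_forall fun q => Set.Subsingleton.measure_zero ?_ _
    intro u hu u' hu'
    have h1 : nudge δ u ((g q.1 : Fin L → ℝ) l) = nudge δ u' ((g q.1 : Fin L → ℝ) l) :=
      (show _ = v from hu).trans (show _ = v from hu').symm
    have h2 : (1 + δ) ≠ 0 := by positivity
    unfold nudge at h1
    rw [div_left_inj' h2] at h1
    exact Subtype.ext (mul_left_cancel₀ hδ.ne' (add_left_cancel h1))

omit [IsProbabilityMeasure P] in
lemma measurePreserving_scorePair (hg : Measurable g) (l : Fin L) :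
    MeasurePreserving (scorePair g l δ) (P.prod (volume : Measure I)) (scoreLaw P g l δ) :=
  ⟨measurable_scorePair hg l, rfl⟩

/-- The (score, label) pair of the test point has the law `scoreLaw`. -/
lemma measurePreserving_test (hg : Measurable g) (l : Fin L) :
    MeasurePreserving (fun q : (X × Fin L) × (Fin L → I) => scorePair g l δ (q.1, q.2 l))
      (P.prod (volume : Measure (Fin L → I))) (scoreLaw P g l δ) :=
  (measurePreserving_scorePair hg l).comp
    ((MeasurePreserving.id P).prod (measurePreserving_eval (fun _ : Fin L => (volume : Measure I)) l))

/-- The sample for class `l` is i.i.d. with law `scoreLaw`, and independent of the seeds that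
perturb the values of the bins. -/
lemma measurePreserving_train (hg : Measurable g) (k : Fin L → ℕ) (l : Fin L) :
    MeasurePreserving (fun ω : (Fin n → X × Fin L) × Seed L n k =>
        (classSample g l δ ω.1 (ω.2.1 l), ω.2.2 l))
      (trainLaw n (Seed L n k) P)
      ((Measure.pi fun _ : Fin n => scoreLaw P g l δ).prod
        (volume : Measure (Fin (n / k l) → I))) := by
  have := isProbabilityMeasure_scoreLaw (P := P) (δ := δ) hg l
  have h1 : MeasurePreserving (fun ω : (Fin n → X × Fin L) × Seed L n k =>
      (ω.1, (ω.2.1 l, ω.2.2 l))) (trainLaw n (Seed L n k) P)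
      ((Measure.pi fun _ : Fin n => P).prod ((volume : Measure (Fin n → I)).prod
        (volume : Measure (Fin (n / k l) → I)))) :=
    (MeasurePreserving.id _).prod
      ((measurePreserving_eval (fun _ : Fin L => (volume : Measure (Fin n → I))) l).prod
        (measurePreserving_eval (fun l : Fin L => (volume : Measure (Fin (n / k l) → I))) l))
  have h2 := (measurePreserving_prodAssoc (Measure.pi fun _ : Fin n => P)
    (volume : Measure (Fin n → I)) (volume : Measure (Fin (n / k l) → I))).symm
  have h3 := (measurePreserving_arrowProdEquivProdArrow (X × Fin L) I (Fin n) (fun _ => P)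
    (fun _ => volume)).symm
  have h4 : MeasurePreserving (fun (a : Fin n → (X × Fin L) × I) i => scorePair g l δ (a i))
      (Measure.pi fun _ => P.prod volume) (Measure.pi fun _ => scoreLaw P g l δ) :=
    measurePreserving_pi _ _ fun _ => measurePreserving_scorePair hg l
  exact ((h4.comp h3).prod (MeasurePreserving.id _)).comp (h2.comp h1)

instance isProbabilityMeasure_trainLaw (k : Fin L → ℕ) :
    IsProbabilityMeasure (trainLaw n (Seed L n k) P) := by
  unfold trainLaw
  infer_instance

variable {k : Fin L → ℕ} {l : Fin L}

lemma ae_goodSample_train (hg : Measurable g) (hδ : 0 < δ) (hk : 2 ≤ k l) (hkn : k l ≤ n) :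
    ∀ᵐ ω ∂trainLaw n (Seed L n k) P, GoodSample (scoreLaw P g l δ) (n / k l) δ
      (classSample g l δ ω.1 (ω.2.1 l)) (ω.2.2 l) := by
  have := isProbabilityMeasure_scoreLaw (P := P) (δ := δ) hg l
  exact (measurePreserving_train hg k l).quasiMeasurePreserving.ae
    ((isScoreLaw_scoreLaw hg hδ l).ae_goodSample hk hkn hδ)

/-- The event that the average label of some bin for class `l` is off by more than `ε`. -/
def badEvent (P : Measure (X × Fin L)) (g : X → stdSimplex ℝ (Fin L)) (k : Fin L → ℕ) (δ : ℝ)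
    (l : Fin L) (ε : ℝ) : Set ((Fin n → X × Fin L) × Seed L n k) :=
  {ω | ∃ b, ε < binErr (scoreLaw P g l δ) (n / k l) (classSample g l δ ω.1 (ω.2.1 l)) b}

lemma measurePreserving_classSample (hg : Measurable g) (k : Fin L → ℕ) (l : Fin L) :
    MeasurePreserving (fun ω : (Fin n → X × Fin L) × Seed L n k =>
        classSample g l δ ω.1 (ω.2.1 l))
      (trainLaw n (Seed L n k) P) (Measure.pi fun _ : Fin n => scoreLaw P g l δ) := by
  have := isProbabilityMeasure_scoreLaw (P := P) (δ := δ) hg l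
  exact measurePreserving_fst.comp (measurePreserving_train hg k l)

lemma measurableSet_exists_lt_binErr {B : ℕ} (Q : Measure (ℝ × ℝ)) [IsProbabilityMeasure Q]
    (ε : ℝ) : MeasurableSet {x : Fin n → ℝ × ℝ | ∃ b : Fin B, ε < binErr Q B x b} :=
  measurableSet_setOfPred.2 (Measurable.exists fun b =>
    measurableSet_setOfPred.1 (measurableSet_lt_binErr ε b))

lemma measurableSet_badEvent (hg : Measurable g) (l : Fin L) (ε : ℝ) :
    MeasurableSet (badEvent (n := n) P g k δ l ε) := by
  have := isProbabilityMeasure_scoreLaw (P := P) (δ := δ) hg l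
  exact (measurePreserving_classSample (P := P) hg k l).measurable
    (measurableSet_exists_lt_binErr _ ε)

lemma measure_badEvent_le (hg : Measurable g) (hδ : 0 < δ) (hk : 2 ≤ k l) (hkn : k l ≤ n)
    {ε : ℝ} (hε : 0 ≤ ε) :
    trainLaw n (Seed L n k) P (badEvent P g k δ l ε) ≤
      ENNReal.ofReal ((n / k l : ℕ) * (2 * Real.exp (-(2 * ((k l : ℝ) - 1) * ε ^ 2)))) := by
  have := isProbabilityMeasure_scoreLaw (P := P) (δ := δ) hg l
  refine le_of_eq_of_le ?_
    ((isScoreLaw_scoreLaw (P := P) hg hδ l).measure_exists_lt_binErr_le hk hkn hε)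
  exact (measurePreserving_classSample hg k l).measure_preimage
    (measurableSet_exists_lt_binErr _ ε).nullMeasurableSet

lemma exp_sqrt_log {a c : ℝ} (ha : 1 ≤ a) (hc : 0 < c) :
    Real.exp (-(2 * c * √(Real.log a / (2 * c)) ^ 2)) = a⁻¹ := by
  have h0 : 0 ≤ Real.log a / (2 * c) := div_nonneg (Real.log_nonneg ha) (by positivity)
  rw [Real.sq_sqrt h0, mul_div_cancel₀ _ (by positivity), Real.exp_neg, Real.exp_log (by linarith)]

omit [MeasurableSpace X] in
lemma exists_classwiseHB_eq_binValue (hδ : 0 < δ) (hkl : 0 < n / k l)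
    {ω : (Fin n → X × Fin L) × Seed L n k}
    (hx : ∀ i, scores (classSample g l δ ω.1 (ω.2.1 l)) i ∈ Set.Icc (0 : ℝ) 1) (x : X)
    (z : Fin L → I) :
    ∃ b, InBin (n / k l) (scores (classSample g l δ ω.1 (ω.2.1 l))) b
        (nudge δ (z l) ((g x : Fin L → ℝ) l)) ∧
      classwiseHB X L n k δ g ω.1 ω.2 x z l =
        binValue (n / k l) δ (classSample g l δ ω.1 (ω.2.1 l)) (ω.2.2 l) b := by
  obtain ⟨b, hb⟩ := exists_inBin hkl (scores (classSample g l δ ω.1 (ω.2.1 l)))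
    (nudge_simplex_mem_Icc hδ (g x) l (z l)).1
  exact ⟨b, hb, (classwiseHB_eq k δ g ω.1 ω.2 x z l).trans (binPredict_of_inBin hx hb)⟩

variable {α : Fin L → ℝ}

lemma measure_badEvent_le_alpha (hg : Measurable g) (hk : 2 ≤ k l) (hn : k l ≤ n) (hδ : 0 < δ)
    (hα : α l ∈ Set.Ioo (0 : ℝ) 1) :
    trainLaw n (Seed L n k) P (badEvent P g k δ l
      √(Real.log (2 * n / (k l * α l)) / (2 * ((k l : ℝ) - 1)))) ≤ ENNReal.ofReal (α l) := by
  have hk2 : (2 : ℝ) ≤ k l := by exact_mod_cast hk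
  have hkn : (k l : ℝ) ≤ n := by exact_mod_cast hn
  have hk0 : (0 : ℝ) < k l := by linarith
  have hn0 : (0 : ℝ) < n := by linarith
  refine (measure_badEvent_le hg hδ hk hn (Real.sqrt_nonneg _)).trans
    (ENNReal.ofReal_le_ofReal ?_)
  rw [exp_sqrt_log _ (by linarith)]
  · have h1 : ((n / k l : ℕ) : ℝ) ≤ n / k l := Nat.cast_div_le
    have h2 := hα.1
    calc ((n / k l : ℕ) : ℝ) * (2 * (2 * n / (k l * α l))⁻¹)
        ≤ (n / k l) * (2 * (2 * n / (k l * α l))⁻¹) := by gcongr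
      _ = α l := by field_simp
  · rw [le_div_iff₀ (mul_pos hk0 hα.1)]
    nlinarith [hα.1, hα.2]

variable [NeZero L]

lemma classProb_binValue (hg : Measurable g) (hδ : 0 < δ) (hkl : 0 < n / k l)
    {ω : (Fin n → X × Fin L) × Seed L n k}
    (h : GoodSample (scoreLaw P g l δ) (n / k l) δ (classSample g l δ ω.1 (ω.2.1 l)) (ω.2.2 l))
    (b : Fin (n / k l)) :
    classProb P (fun x z => classwiseHB X L n k δ g ω.1 ω.2 x z l) l
        (binValue (n / k l) δ (classSample g l δ ω.1 (ω.2.1 l)) (ω.2.2 l) b) =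
      stripProb (scoreLaw P g l δ) (binLo _ b (classSample g l δ ω.1 (ω.2.1 l)))
        (binHi _ b (classSample g l δ ω.1 (ω.2.1 l))) :=
  h.condDistrib_binPredict (isScoreLaw_scoreLaw hg hδ l) hkl
    (S := fun q : (X × Fin L) × (Fin L → I) => nudge δ (q.2 l) ((g q.1.1 : Fin L → ℝ) l))
    ((measurable_nudge_apply hg l).comp (by fun_prop : Measurable fun q :
      (X × Fin L) × (Fin L → I) => (q.1.1, q.2 l)))
    (by fun_prop) (measurePreserving_test hg l).map_eq b

lemma cwECE_eq (hg : Measurable g) (hδ : 0 < δ) (hk : ∀ l, 0 < n / k l)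
    {ω : (Fin n → X × Fin L) × Seed L n k}
    (h : ∀ l, GoodSample (scoreLaw P g l δ) (n / k l) δ (classSample g l δ ω.1 (ω.2.1 l))
      (ω.2.2 l)) :
    cwECE P (classwiseHB X L n k δ g ω.1 ω.2) = (L : ℝ)⁻¹ * ∑ l,
      binECE (scoreLaw P g l δ) (n / k l) δ (classSample g l δ ω.1 (ω.2.1 l)) (ω.2.2 l) := by
  unfold cwECE
  congr 1
  refine Finset.sum_congr rfl fun l _ => ?_
  have := isProbabilityMeasure_scoreLaw (P := P) (δ := δ) hg l
  exact (h l).integral_abs_condDistrib_sub (isScoreLaw_scoreLaw hg hδ l) (hk l)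
    (S := fun q : (X × Fin L) × (Fin L → I) => nudge δ (q.2 l) ((g q.1.1 : Fin L → ℝ) l))
    ((measurable_nudge_apply hg l).comp (by fun_prop : Measurable fun q :
      (X × Fin L) × (Fin L → I) => (q.1.1, q.2 l)))
    (by fun_prop) (measurePreserving_test hg l).map_eq

/-- Class-wise histogram binning is marginally class-wise calibrated. -/
theorem marginallyCalibrated_classwiseHB (hk : ∀ l, 2 ≤ k l) (hn : ∀ l, k l ≤ n) (hδ : 0 < δ)
    (hα : ∀ l, α l ∈ Set.Ioo (0 : ℝ) 1) :
    MarginallyCalibrated (classwiseHB X L n k δ)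
      (fun l => √(Real.log (2 / α l) / (2 * ((k l : ℝ) - 1))) + δ) α := by
  intro g hg P _ l
  have hQp := isProbabilityMeasure_scoreLaw (P := P) (δ := δ) hg l
  have hQ := isScoreLaw_scoreLaw (P := P) hg hδ l
  set Q := scoreLaw P g l δ
  set ε := √(Real.log (2 / α l) / (2 * ((k l : ℝ) - 1)))
  have hε : 0 ≤ ε := Real.sqrt_nonneg _
  have hkl : 0 < n / k l := Nat.div_pos (hn l) (by linarith [hk l])
  have hk1 : (0 : ℝ) < (k l : ℝ) - 1 := by
    have : (2 : ℝ) ≤ k l := by exact_mod_cast hk l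
    linarith
  have hbound : 2 * Real.exp (-(2 * ((k l : ℝ) - 1) * ε ^ 2)) = α l := by
    rw [exp_sqrt_log _ hk1]
    · have := (hα l).1.ne'
      field_simp
    · rw [le_div_iff₀ (hα l).1]; linarith [(hα l).2]
  have hMP := (measurePreserving_classSample (P := P) (δ := δ) (n := n) hg k l).prod
    (measurePreserving_test (P := P) (δ := δ) hg l)
  set N : Set ((Fin n → ℝ × ℝ) × (ℝ × ℝ)) := {q | ∃ b : Fin (n / k l),
    InBin (n / k l) (scores q.1) b q.2.1 ∧ ε < binErr Q (n / k l) q.1 b}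
  have hN : MeasurableSet N := by
    refine measurableSet_setOfPred.2 (Measurable.exists fun b => Measurable.and
      (measurableSet_setOfPred.1 ?_) (measurableSet_setOfPred.1 ?_))
    · exact (by fun_prop : Measurable fun q : (Fin n → ℝ × ℝ) × (ℝ × ℝ) => (scores q.1, q.2.1))
        (measurableSet_inBin b)
    · exact measurable_fst (measurableSet_lt_binErr ε b)
  refine probAtLeast_of_ae (hMP.measurable hN) (hα l).1.le ?_ ?_
  · rw [hMP.measure_preimage hN.nullMeasurableSet, ← hbound]
    exact hQ.measure_exists_inBin_le (hk l) (hn l) hε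
  · filter_upwards [Measure.quasiMeasurePreserving_fst.ae
      (ae_goodSample_train (P := P) hg hδ (hk l) (hn l))] with ω hω hωN
    obtain ⟨b, hb, hval⟩ := exists_classwiseHB_eq_binValue (ω := ω.1) hδ hkl hω.noTies.mem_Icc
      ω.2.1.1 ω.2.2
    have herr : binErr Q (n / k l) (classSample g l δ ω.1.1 (ω.1.2.1 l)) b ≤ ε :=
      not_lt.1 fun hlt => hωN ⟨b, hb, hlt⟩
    rw [hval, classProb_binValue hg hδ hkl hω b]
    exact (abs_stripProb_sub_binValue_le hδ hω.label_mem _ b).trans (by linarith)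

/-- Class-wise histogram binning is conditionally class-wise calibrated. -/
theorem conditionallyCalibrated_classwiseHB (hk : ∀ l, 2 ≤ k l) (hn : ∀ l, k l ≤ n)
    (hδ : 0 < δ) (hα : ∀ l, α l ∈ Set.Ioo (0 : ℝ) 1) :
    ConditionallyCalibrated (classwiseHB X L n k δ)
      (fun l => √(Real.log (2 * n / (k l * α l)) / (2 * ((k l : ℝ) - 1))) + δ) α := by
  intro g hg P _ l
  have hkl : 0 < n / k l := Nat.div_pos (hn l) (by linarith [hk l])
  refine probAtLeast_of_ae (measurableSet_badEvent (P := P) hg l _) (hα l).1.le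
    (measure_badEvent_le_alpha hg (hk l) (hn l) hδ (hα l)) ?_
  filter_upwards [ae_goodSample_train (P := P) hg hδ (hk l) (hn l)] with ω hω hωN
  rintro _ ⟨⟨x, z⟩, rfl⟩
  obtain ⟨b, -, hval⟩ := exists_classwiseHB_eq_binValue (ω := ω) hδ hkl hω.noTies.mem_Icc x z
  have herr := not_lt.1 fun hlt => hωN ⟨b, hlt⟩
  simp only [hval]
  rw [classProb_binValue hg hδ hkl hω b]
  exact (abs_stripProb_sub_binValue_le hδ hω.label_mem _ b).trans (by linarith)

lemma average_le_iSup (c : Fin L → ℝ) : (L : ℝ)⁻¹ * ∑ l, c l ≤ ⨆ l, c l := by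
  have hL : (0 : ℝ) < L := by exact_mod_cast Nat.pos_of_ne_zero (NeZero.ne L)
  rw [inv_mul_le_iff₀ hL]
  refine (Finset.sum_le_card_nsmul _ _ (⨆ l, c l) fun l _ =>
    le_ciSup (Set.finite_range c).bddAbove l).trans_eq (by simp)

theorem probAtLeast_cwECE_le (hk : ∀ l, 2 ≤ k l) (hn : ∀ l, k l ≤ n) (hδ : 0 < δ)
    (hα : ∀ l, α l ∈ Set.Ioo (0 : ℝ) 1) (hg : Measurable g) (P : Measure (X × Fin L))
    [IsProbabilityMeasure P] :
    ProbAtLeast (trainLaw n (Seed L n k) P)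
      {ω | cwECE P (classwiseHB X L n k δ g ω.1 ω.2) ≤
        ⨆ l, (√(Real.log (2 * n / (k l * α l)) / (2 * ((k l : ℝ) - 1))) + δ)}
      (1 - ∑ l, α l) := by
  have hkl : ∀ l, 0 < n / k l := fun l => Nat.div_pos (hn l) (by linarith [hk l])
  refine probAtLeast_of_ae (N := ⋃ l, badEvent P g k δ l
    √(Real.log (2 * n / (k l * α l)) / (2 * ((k l : ℝ) - 1))))
    (MeasurableSet.iUnion fun l => measurableSet_badEvent hg l _)
    (Finset.sum_nonneg fun l _ => (hα l).1.le) ?_ ?_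
  · rw [ENNReal.ofReal_sum_of_nonneg fun l _ => (hα l).1.le]
    exact (measure_iUnion_fintype_le _ _).trans (Finset.sum_le_sum fun l _ =>
      measure_badEvent_le_alpha hg (hk l) (hn l) hδ (hα l))
  · have hgood : ∀ᵐ ω ∂trainLaw n (Seed L n k) P, ∀ l, GoodSample (scoreLaw P g l δ) (n / k l) δ
        (classSample g l δ ω.1 (ω.2.1 l)) (ω.2.2 l) :=
      ae_all_iff.2 fun l => ae_goodSample_train hg hδ (hk l) (hn l)
    filter_upwards [hgood] with ω hω hωN
    rw [cwECE_eq hg hδ hkl hω]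
    refine le_trans ?_ (average_le_iSup _)
    gcongr with l _
    have := isProbabilityMeasure_scoreLaw (P := P) (δ := δ) hg l
    exact (hω l).binECE_le hδ (Real.sqrt_nonneg _) fun b =>
      not_lt.1 fun hlt => hωN (Set.mem_iUnion.2 ⟨l, b, hlt⟩)

theorem integral_cwECE_le (hk : ∀ l, 2 ≤ k l) (hn : ∀ l, k l ≤ n) (hδ : 0 < δ)
    (hg : Measurable g) (P : Measure (X × Fin L)) [IsProbabilityMeasure P] :
    Integrable (fun ω => cwECE P (classwiseHB X L n k δ g ω.1 ω.2))
        (trainLaw n (Seed L n k) P) ∧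
      ∫ ω, cwECE P (classwiseHB X L n k δ g ω.1 ω.2) ∂(trainLaw n (Seed L n k) P) ≤
        (⨆ l, √(1 / (2 * (k l : ℝ)))) + δ := by
  have hkl : ∀ l, 0 < n / k l := fun l => Nat.div_pos (hn l) (by linarith [hk l])
  have hae : (fun ω => cwECE P (classwiseHB X L n k δ g ω.1 ω.2)) =ᵐ[trainLaw n (Seed L n k) P]
      fun ω => (L : ℝ)⁻¹ * ∑ l, binECE (scoreLaw P g l δ) (n / k l) δ
        (classSample g l δ ω.1 (ω.2.1 l)) (ω.2.2 l) := by
    have hgood : ∀ᵐ ω ∂trainLaw n (Seed L n k) P, ∀ l, GoodSample (scoreLaw P g l δ) (n / k l) δ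
        (classSample g l δ ω.1 (ω.2.1 l)) (ω.2.2 l) :=
      ae_all_iff.2 fun l => ae_goodSample_train hg hδ (hk l) (hn l)
    filter_upwards [hgood] with ω hω using cwECE_eq hg hδ hkl hω
  have hint : ∀ l, Integrable (fun ω => binECE (scoreLaw P g l δ) (n / k l) δ
      (classSample g l δ ω.1 (ω.2.1 l)) (ω.2.2 l)) (trainLaw n (Seed L n k) P) := fun l => by
    have := isProbabilityMeasure_scoreLaw (P := P) (δ := δ) hg l
    exact (measurePreserving_train hg k l).integrable_comp_of_integrable
      ((isScoreLaw_scoreLaw hg hδ l).integrable_binECE (hk l) (hn l) hδ)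
  refine ⟨((integrable_finsetSum _ fun l _ => hint l).const_mul _).congr hae.symm, ?_⟩
  rw [integral_congr_ae hae, integral_const_mul, integral_finsetSum _ fun l _ => hint l]
  have hle : ∀ l, ∫ ω, binECE (scoreLaw P g l δ) (n / k l) δ
      (classSample g l δ ω.1 (ω.2.1 l)) (ω.2.2 l) ∂(trainLaw n (Seed L n k) P) ≤
        (⨆ l, √(1 / (2 * (k l : ℝ)))) + δ := fun l => by
    have := isProbabilityMeasure_scoreLaw (P := P) (δ := δ) hg l
    have hMP := measurePreserving_train (P := P) (δ := δ) (n := n) hg k l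
    have h1 := (isScoreLaw_scoreLaw (P := P) hg hδ l).integral_binECE_le (hk l) (hn l) hδ
    rw [← hMP.map_eq, integral_map hMP.measurable.aemeasurable
      measurable_binECE.aestronglyMeasurable] at h1
    refine h1.trans (add_le_add_left ?_ δ)
    exact le_ciSup (f := fun l => √(1 / (2 * (k l : ℝ)))) (Set.finite_range _).bddAbove l
  refine (average_le_iSup _).trans (ciSup_le hle)

end ClasswiseCalibration

end ClasswiseHB

theorem mainTheorem2 {X : Type*} [MeasurableSpace X] (L n : ℕ) [NeZero L]
    (k : Fin L → ℕ) (hk : ∀ l, 2 ≤ k l) (hn : ∀ l, k l ≤ n)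
    (δ : ℝ) (hδ : 0 < δ)
    (α : Fin L → ℝ) (hα : ∀ l, α l ∈ Set.Ioo (0 : ℝ) 1)
    (ε₁ ε₂ : Fin L → ℝ)
    (hε₁ : ∀ l, ε₁ l = √(Real.log (2 / α l) / (2 * ((k l : ℝ) - 1))) + δ)
    (hε₂ : ∀ l, ε₂ l = √(Real.log (2 * n / (k l * α l)) / (2 * ((k l : ℝ) - 1))) + δ) :
    ClasswiseHB.MarginallyCalibrated (ClasswiseHB.classwiseHB X L n k δ) ε₁ α ∧
    ClasswiseHB.ConditionallyCalibrated (ClasswiseHB.classwiseHB X L n k δ) ε₂ α ∧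
    ∀ g : X → stdSimplex ℝ (Fin L), Measurable g →
    ∀ (P : Measure (X × Fin L)) [IsProbabilityMeasure P],
      ClasswiseHB.ProbAtLeast (ClasswiseHB.trainLaw n (ClasswiseHB.Seed L n k) P)
        {ω | ClasswiseHB.cwECE P (ClasswiseHB.classwiseHB X L n k δ g ω.1 ω.2) ≤ ⨆ l, ε₂ l}
        (1 - ∑ l, α l) ∧
      Integrable
        (fun ω => ClasswiseHB.cwECE P (ClasswiseHB.classwiseHB X L n k δ g ω.1 ω.2))
        (ClasswiseHB.trainLaw n (ClasswiseHB.Seed L n k) P) ∧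
      ∫ ω, ClasswiseHB.cwECE P (ClasswiseHB.classwiseHB X L n k δ g ω.1 ω.2)
          ∂(ClasswiseHB.trainLaw n (ClasswiseHB.Seed L n k) P)
        ≤ (⨆ l, √(1 / (2 * (k l : ℝ)))) + δ := by
  obtain rfl : ε₁ = _ := funext hε₁
  obtain rfl : ε₂ = _ := funext hε₂
  exact ⟨ClasswiseHB.marginallyCalibrated_classwiseHB hk hn hδ hα,
    ClasswiseHB.conditionallyCalibrated_classwiseHB hk hn hδ hα, fun g hg P _ =>
      ⟨ClasswiseHB.probAtLeast_cwECE_le hk hn hδ hα hg P,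
        ClasswiseHB.integral_cwECE_le hk hn hδ hg P⟩⟩
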